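/- **Setting.** Let $p$ be a prime, $\mathbb{F}_q$ a finite field of characteristic $p$ containing a primitive $N$-th root of unity ($N\ge 1$), $K=\mathrm{Frac}(W(\mathbb{F}_q))$ with its $p$-adic absolute value, $\mu_N=\mu_N(K)$ and $\alpha\ge 1$. Let $K\langle\langle e_Z\rangle\rangle$ be the algebra of non-commutative formal power series $f=\sum_w f[w]\,w$ in the letters $e_0$ and $e_z$ ($z\in\mu_N$). The weight of a word is its number of letters, its depth the number of letters different from $e_0$. *The group.* $\tilde\Pi_{1,0}(K)_\Sigma$ is the set of $g\in K\langle\langle e_Z\rangle\rangle$ that satisfy the shuffle equation ($g[\emptyset]=1$ and $g[u]g[v]=g[u \mathbin{\mathrm{sh}} v]$ for all words $u,v$, where $\mathrm{sh}$ is the shuffle product), with $g[e_0]=g[e_1]=0$ and such that, for each $d\ge 1$, $g[w]\to 0$ when the weight of $w$ tends to infinity, $w$ running over the words of depth $d$. Let $\mathrm{Ad}_{\tilde\Pi_{1,0}(K)_\Sigma}(e_1)=\{g^{-1}e_1g : g\in\tilde\Pi_{1,0}(K)_\Sigma\}$. *Harmonic words.* A harmonic word is $w=\binom{z_{d+1},\ldots,z_1}{s_d,\ldots,s_1}$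 with $d\ge 0$, $z_i\in\mu_N$, $s_i\ge 1$; it is identified with the word $e_{z_{d+1}}e_0^{s_d-1}e_{z_d}\cdots e_0^{s_1-1}e_{z_1}$. A family $h=(h(w))_w$ indexed by harmonic words is viewed as a series with coefficient $h(w)$ at $e_0^l w$ for every $l\ge 0$ (and $0$ at the other words). For $n\in\mathbb{N}$, $$\mathrm{har}_n^{(p^\alpha)}(w)=n^{s_1+\cdots+s_d}\sum_{0<n_1<\cdots<n_d<n}\frac{(x_2/x_1)^{n_1}\cdots(x_{d+1}/x_d)^{n_d}(1/x_{d+1})^n}{n_1^{s_1}\cdots n_d^{s_d}},\qquad x_i=z_i^{p^\alpha}.$$ *The action.* For $G\in\mathrm{Ad}_{\tilde\Pi_{1,0}(K)_\Sigma}(e_1)$, let $G^{(z)}$ be the image of $G$ under $e_0\mapsto e_0$, $e_{z'}\mapsto e_{zz'}$, and let $G_n$ be the series with $G_n[w]=n^{\mathrm{weight}(w)-1}G[w]$. For $h=(h_n)_{n\in\mathbb{N}}$, the DR-RT harmonic Ihara action is $$(G\circ_{\mathrm{har}}^{\mathrm{DR}\text{-}\mathrm{RT}}h)_n(w)=\lim_{l\to\infty}\Big(h_n\big(e_0,(G_n^{(z)})_{z\in\mu_N}\big)\Big)[e_0^l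 w],$$ where $G_n^{(z)}$ is substituted for $e_z$. Let $\mathrm{Orb}_{\mathrm{har}_\mathbb{N}}$ be the set of all $G\circ_{\mathrm{har}}^{\mathrm{DR}\text{-}\mathrm{RT}}(\mathrm{har}_n^{(p^\alpha)})_{n\in\mathbb{N}}$, $G\in\mathrm{Ad}_{\tilde\Pi_{1,0}(K)_\Sigma}(e_1)$. *Quasi-shuffle relations.* For $z\in\mu_N$ and a word $u=(s_d,\epsilon_d)\cdots(s_1,\epsilon_1)$ in the letters of $\mathbb{N}^*\times\mu_N$, let $[z;u]$ be the harmonic word with $z_{d+1}=z$ and $z_{i+1}/z_i=\epsilon_i$ for $1\le i\le d$. Let $*$ be the quasi-shuffle product of such words, in which the letters $(s,\epsilon)$ and $(t,\eta)$ contract to $(s+t,\epsilon\eta)$. Harmonic-word-indexed families and series are extended linearly to combinations of words. A sequence $(h_n)_n$ satisfies the quasi-shuffle relation if $h_n([y;u])\,h_n([z;v])=h_n([yz;u*v])$ for all $n,y,z,u,v$. A series $G$ satisfies the adjoint quasi-shuffle relation if, for all $b\ge 0$, $x\in\mu_N$ and $u,v$, $$G\big[e_0^b\,[x;u*v]\big]=\sum_{b'+b''=b}\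 \sum_{x'x''=x}G\big[e_0^{b'}[x';u]\big]\,G\big[e_0^{b''}[x'';v]\big].$$ **Theorem.** Let $g\in\mathrm{Ad}_{\tilde\Pi_{1,0}(K)_\Sigma}(e_1)$ and $f\in\mathrm{Orb}_{\mathrm{har}_\mathbb{N}}$. If $f$ and $g\circ_{\mathrm{har}}^{\mathrm{DR}\text{-}\mathrm{RT}}f$ satisfy the quasi-shuffle relation, then $g$ satisfies the adjoint quasi-shuffle relation. -/

import Mathlib

open Filter Topology

namespace HarmonicIhara

/-! ### Words and non-commutative formal power series

`M` is a finite group of roots of unity. The alphabet `e_Z` is `Option M`: the letter `e_0` is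
`none`, and the letter `e_z`, `z ∈ M`, is `some z`. Words are read from left to right. -/

/-- Words on the alphabet `e_Z`. -/
abbrev Word (M : Type*) := List (Option M)

/-- The depth of a word: its number of letters different from `e_0`.
The weight of a word is its length. -/
def depth {M : Type*} (w : Word M) : ℕ := w.countP Option.isSome

/-- The non-commutative formal power series `A⟨⟨e_Z⟩⟩`, a series `f` being given by its
coefficients `f w = f[w]`. -/
def Series (M A : Type*) := Word M → A

section Algebra

variable {M A : Type*} [CommRing A]

/-- The series `1` (the empty word). -/
instance : One (Series M A) := ⟨fun w => if w = [] then 1 else 0⟩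

/-- The concatenation product: `(f g)[w] = ∑_{uv = w} f[u] g[v]`. -/
instance : Mul (Series M A) :=
  ⟨fun f g w => ∑ i ∈ Finset.range (w.length + 1), f (w.take i) * g (w.drop i)⟩

open Classical in
/-- The series consisting of the single letter `a`. -/
noncomputable def letter (a : Option M) : Series M A := fun w => if w = [a] then 1 else 0

/-- The substitution `F(φ(e_0), φ(e_{z_1}), …, φ(e_{z_N}))`, for series `φ a` without constant
term: `∑_w F[w] φ(w)`, where `φ(a_1 ⋯ a_k) = φ(a_1) ⋯ φ(a_k)`. Since the `φ a` have no constant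
term, words `w` longer than `v` do not contribute to the coefficient of `v`. -/
def subst [Fintype M] (φ : Option M → Series M A) (F : Series M A) : Series M A := fun v =>
  ∑ k ∈ Finset.range (v.length + 1), ∑ w : Fin k → Option M,
    F (List.ofFn w) * (((List.ofFn w).map φ).prod : Series M A) v

/-- The shuffles of two words, listed with multiplicity. -/
def shuffle {X : Type*} : List X → List X → List (List X)
  | [], v => [v]
  | a :: u, [] => [a :: u]
  | a :: u, b :: v =>
      (shuffle u (b :: v)).map (a :: ·) ++ (shuffle (a :: u) v).map (b :: ·)
termination_by u v => u.length + v.length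

/-- The shuffle equation: it defines the set of `A`-points of the de Rham fundamental group inside
`A⟨⟨e_Z⟩⟩`. -/
def ShuffleEquation (f : Series M A) : Prop :=
  f [] = 1 ∧ ∀ u v : Word M, f u * f v = ((shuffle u v).map f).sum

/-- The push-forward by `x ↦ z x`: the algebra automorphism with `e_0 ↦ e_0`,
`e_{z'} ↦ e_{z z'}`, on coefficients. -/
def rotate [CommGroup M] (z : M) (f : Series M A) : Series M A := fun w =>
  f (w.map (Option.map (z⁻¹ * ·)))

/-- The adjoint Ihara product: `G ∘_Ad F = F(e_0, G^{(z_1)}, …, G^{(z_N)})`, where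
`G^{(z)} = (x ↦ z x)_* G`. When `G = g⁻¹ e_1 g` and `F = f⁻¹ e_1 f` it is
`Ad_{g ∘ f}(e_1)` for the Ihara product `g ∘ f = g · f(e_0, (g_z⁻¹ e_z g_z)_z)`. -/
noncomputable def adIhara [CommGroup M] [Fintype M] (G F : Series M A) : Series M A :=
  subst (fun a => match a with
    | none => letter none
    | some z => rotate z G) F

/-- The action of `τ(n)` on the elements `G = g⁻¹ e_1 g`: `τ(n)(Ad_g(e_1)) = Ad_{τ(n) g}(e_1)`,
where `τ(n)` multiplies the coefficient of `w` in `g` by `n ^ weight(w)`; the letter `e_1` itself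
is not rescaled, whence the exponent `weight(w) - 1` (and `G` has no constant term). -/
def tauAd (n : ℕ) (G : Series M A) : Series M A := fun w => (n : A) ^ (w.length - 1) * G w

end Algebra

/-! ### Harmonic words -/

/-- The harmonic word `(z_{d+1}, z_d, …, z_1 ; s_d, …, s_1)`, given by `head = z_{d+1}` and
`tail = [(s_d, z_d), …, (s_1, z_1)]`. -/
structure HarWord (M : Type*) where
  head : M
  tail : List (ℕ+ × M)

/-- The word `e_{z_{d+1}} e_0^{s_d - 1} e_{z_d} ⋯ e_0^{s_1 - 1} e_{z_1}`. -/
def HarWord.toWord {M : Type*} (w : HarWord M) : Word M :=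
  some w.head :: w.tail.flatMap fun x => List.replicate ((x.1 : ℕ) - 1) none ++ [some x.2]

/-- Reads a word as `e_0^{s_d - 1 - k} e_{z_d} e_0^{s_{d-1}-1} e_{z_{d-1}} ⋯ e_0^{s_1 - 1} e_{z_1}`
and returns `[(s_d, z_d), …, (s_1, z_1)]`, when possible. -/
def blocks {M : Type*} : ℕ → Word M → Option (List (ℕ+ × M))
  | 0, [] => some []
  | _ + 1, [] => none
  | k, none :: w => blocks (k + 1) w
  | k, some z :: w => (blocks 0 w).map fun t => (k.succPNat, z) :: t

/-- A family `h` indexed by harmonic words, viewed as an element of `A⟨⟨e_Z⟩⟩` whose coefficients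
satisfy `f[e_0^l w] = h(w)` for all `l`. The coefficients of the words that end with `e_0` (and
of the empty word) never contribute to the coefficients of the other words in `adIhara`; they are
put equal to `0`. -/
def toSeries {M A : Type*} [Zero A] (h : HarWord M → A) : Series M A
  | [] => 0
  | none :: w => toSeries h w
  | some z :: w =>
      match blocks 0 w with
      | none => 0
      | some t => h ⟨z, t⟩

theorem blocks_replicate {M : Type*} (m : ℕ) (k : ℕ) (w : Word M) (z : M) :
    blocks k (List.replicate m none ++ some z :: w) =
      (blocks 0 w).map fun t => ((k + m).succPNat, z) :: t := by
  induction m generalizing k with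
  | zero => cases k <;> simp [blocks]
  | succ m ih =>
    rw [List.replicate_succ, List.cons_append, show k + (m + 1) = k + 1 + m by omega, ← ih (k + 1)]
    cases k <;> simp [blocks]

theorem blocks_flatMap {M : Type*} (t : List (ℕ+ × M)) :
    blocks 0 (t.flatMap fun x => List.replicate ((x.1 : ℕ) - 1) none ++ [some x.2]) = some t := by
  induction t with
  | nil => simp [blocks]
  | cons x t ih =>
    rw [List.flatMap_cons, List.append_assoc, List.singleton_append, blocks_replicate, ih]
    obtain ⟨s, z⟩ := x
    have : (s : ℕ) - 1 + 1 = s := Nat.sub_add_cancel s.pos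
    simp [← PNat.coe_inj, this]

/-- `toSeries h` has the coefficient `h(w)` at every word `e_0^l w`. -/
theorem toSeries_apply {M A : Type*} [Zero A] (h : HarWord M → A) (l : ℕ) (w : HarWord M) :
    toSeries h (List.replicate l none ++ w.toWord) = h w := by
  induction l with
  | zero => simp [HarWord.toWord, toSeries, blocks_flatMap]
  | succ l ih => simpa [List.replicate_succ, toSeries] using ih

/-! ### The harmonic Ihara action -/

section Action

variable {M A : Type*} [CommGroup M] [Fintype M] [CommRing A] [TopologicalSpace A]

/-- The DR-RT harmonic Ihara action: `G ∘_har (n ↦ h_n) = (n ↦ lim (τ(n)(G) ∘_Ad h_n))`, where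
`(lim f)[w] = lim_{l → ∞} f[e_0^l w]`. -/
noncomputable def harIhara (G : Series M A) (h : ℕ → HarWord M → A) : ℕ → HarWord M → A :=
  fun n w => limUnder atTop fun l : ℕ =>
    adIhara (tauAd n G) (toSeries (h n)) (List.replicate l none ++ w.toWord)

end Action

/-- The set `Π̃_{1,0}(A)_Σ`: the solutions `g` of the shuffle equation such that
`g[e_0] = g[e_1] = 0` and such that, for each depth `d ≥ 1`, the coefficients `g[w]` for words `w`
of depth `d` tend to `0` when the weight of `w` tends to infinity. -/
def PiTildeSigma (M A : Type*) [CommGroup M] [NormedField A] : Set (Series M A) :=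
  {g | ShuffleEquation g ∧ g [none] = 0 ∧ g [some 1] = 0 ∧
    ∀ d : ℕ, 1 ≤ d → ∀ ε : ℝ, 0 < ε → ∃ S : ℕ, ∀ w : Word M,
      S ≤ w.length → depth w = d → ‖g w‖ < ε}

/-- The set `Ad_{Π̃_{1,0}(A)_Σ}(e_1)` of the series `g⁻¹ e_1 g` with `g ∈ Π̃_{1,0}(A)_Σ`. -/
def AdPiTildeSigma (M A : Type*) [CommGroup M] [NormedField A] : Set (Series M A) :=
  {G | ∃ g ∈ PiTildeSigma M A, ∃ g' : Series M A,
    g' * g = 1 ∧ g * g' = 1 ∧ G = g' * letter (some 1) * g}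

/-! ### Multiple harmonic sums -/

section Sums

variable {M K : Type*} [Field K]

/-- The sum over `0 < n_1 < ⋯ < n_d < n` of
`(z_2/z_1)^{n_1} ⋯ (z_{d+1}/z_d)^{n_d} / (n_1^{s_1} ⋯ n_d^{s_d})`, where `z = z_{d+1}`, the list is
`[(s_d, z_d), …, (s_1, z_1)]`, and where the elements of `M` are viewed in `K` through `ι`. -/
def nestedSum (ι : M → K) : ℕ → M → List (ℕ+ × M) → K
  | _, _, [] => 1
  | n, z, (s, z') :: t =>
      ∑ m ∈ Finset.Ioo 0 n, (ι z / ι z') ^ m / (m : K) ^ (s : ℕ) * nestedSum ι m z' t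

/-- The weighted multiple harmonic sum `har_n(w)`: the sum above times
`n^{s_d + ⋯ + s_1} (1/z_{d+1})^n`. -/
def har (ι : M → K) (n : ℕ) (w : HarWord M) : K :=
  (n : K) ^ (w.tail.map fun x => (x.1 : ℕ)).sum * nestedSum ι n w.head w.tail *
    (1 / ι w.head) ^ n

end Sums

/-- The sequence `har_ℕ^{(p^α)}` (with `r = p^α`): the weighted multiple harmonic sums in which
every `N`-th root of unity `z_i` is replaced by `z_i^{p^α}`. -/
def harPow (N : ℕ) (K : Type*) [Field K] (r : ℕ) : ℕ → HarWord (rootsOfUnity N K) → K :=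
  har fun z => ((z : Kˣ) : K) ^ r

/-- The orbit `Orb_{har_ℕ}` of `har_ℕ^{(p^α)}` (with `r = p^α`) under the DR-RT harmonic Ihara
action of `Ad_{Π̃_{1,0}(K)_Σ}(e_1)`. -/
def orbitHar (N : ℕ) [NeZero N] (K : Type*) [NormedField K] [Fintype (rootsOfUnity N K)] (r : ℕ) :
    Set (ℕ → HarWord (rootsOfUnity N K) → K) :=
  {f | ∃ G ∈ AdPiTildeSigma (rootsOfUnity N K) K, f = harIhara G (harPow N K r)}

/-! ### Quasi-shuffle relations -/

section QuasiShuffle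

variable {M A : Type*} [CommGroup M]

/-- The quasi-shuffle product of two words in the letters `(s, ε)`, where the product of two
letters is `(s, ε) (t, η) = (s + t, ε η)`, as a list of words with multiplicity. -/
def stuffle : List (ℕ+ × M) → List (ℕ+ × M) → List (List (ℕ+ × M))
  | [], v => [v]
  | a :: u, [] => [a :: u]
  | a :: u, b :: v =>
      (stuffle u (b :: v)).map (a :: ·) ++ (stuffle (a :: u) v).map (b :: ·) ++
        (stuffle u v).map ((a.1 + b.1, a.2 * b.2) :: ·)
termination_by u v => u.length + v.length

/-- From `z_{d+1}` and the list of the `(s_i, ε_i)`, `ε_i = z_{i+1}/z_i`, to the list of the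
`(s_i, z_i)`, where `i` decreases from `d` to `1`. -/
def ofRatiosAux : M → List (ℕ+ × M) → List (ℕ+ × M)
  | _, [] => []
  | z, (s, ε) :: u => (s, z / ε) :: ofRatiosAux (z / ε) u

/-- The harmonic word `(z_{d+1}, …, z_1 ; s_d, …, s_1)` with `z_{d+1} = z` and
`z_{i+1} / z_i = ε_i`, where `u = [(s_d, ε_d), …, (s_1, ε_1)]`. Every harmonic word is of this form
in exactly one way; the `ε_i` are the numbers whose `n_i`-th powers occur in `har_n`. -/
def ofRatios (z : M) (u : List (ℕ+ × M)) : HarWord M := ⟨z, ofRatiosAux z u⟩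

/-- The quasi-shuffle relation `h_n(w) h_n(w') = h_n(w * w')` for a sequence of families indexed
by harmonic words. -/
def QuasiShuffle [CommRing A] (h : ℕ → HarWord M → A) : Prop :=
  ∀ (n : ℕ) (y z : M) (u v : List (ℕ+ × M)),
    h n (ofRatios y u) * h n (ofRatios z v) =
      ((stuffle u v).map fun w => h n (ofRatios (y * z) w)).sum

/-- The adjoint quasi-shuffle relation for `G ∈ A⟨⟨e_Z⟩⟩`. In terms of the generating series
`∑_b Λ^b G[e_0^b w]`, `w` being a harmonic word, it is the quasi-shuffle relation, the product
being convoluted over the group of roots of unity. For `N = 1`, it is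
`G[e_0^b e_1 (w * w')] = ∑_{b' + b'' = b} G[e_0^{b'} e_1 w] G[e_0^{b''} e_1 w']`. -/
def AdjointQuasiShuffle [Fintype M] [CommRing A] (G : Series M A) : Prop :=
  ∀ (b : ℕ) (x : M) (u v : List (ℕ+ × M)),
    ((stuffle u v).map fun w => G (List.replicate b none ++ (ofRatios x w).toWord)).sum =
      ∑ c ∈ Finset.range (b + 1), ∑ y : M,
        G (List.replicate c none ++ (ofRatios y u).toWord) *
          G (List.replicate (b - c) none ++ (ofRatios (x / y) v).toWord)

end QuasiShuffle

end HarmonicIhara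

open HarmonicIhara

/-!
Let `ι z = z ^ (p ^ α)`, write `f = F ∘_har har`, and write `G` for the series called `g` in the
theorem: both `F` and `G` are conjugates `γ⁻¹ e_1 γ` of `e_1`.

The series `G` has no coefficient in depth `0`, reduces to `e_1` in depth `1`, and has coefficients
that decay in each depth (`isAdjointSeries_of_mem`). Hence `(G ∘_har h)_n(w)` is a finite linear
combination of the `h_n(w')`, with `w'` of weight at most that of `w`. Its coefficients are
convergent power series in `n`; they vanish when `w'` is deeper than `w`, and the part of equal
depth is the identity (`harIhara_apply`, `transition_of_depth_lt`, `transition_of_depth_eq`). For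
`w' = e_x`, the coefficient is, up to a power of `n`, the series `∑_b n ^ b G^{(x)}[e_0 ^ b w]`
(`headSeries`): these series contain the coefficients of `G` which occur in the adjoint
quasi-shuffle relation.

The key fact is that, for `n` in a class modulo `N`, the multiple harmonic sums, viewed as germs at
infinity of functions of `n`, are linearly independent over the field of fractions of the ring of
convergent power series (`linearIndependent_ratioGerm`). The difference for the step `n ↦ n + N`
lowers the depth of a multiple harmonic sum, so by a difference-field argument
(`linearIndependent_of_difference`) it suffices to know that no nontrivial combination of the
functions `∑_{i < N} ι ε ^ (n + i) / (n + i) ^ s` is a difference `q(n + N) - q(n)`. Such a `q`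
would have a pole, and the pole would propagate to infinitely many integers
(`eq_zero_of_difference`), whereas a nonzero convergent power series has finitely many zeros on the
integers, by Strassmann's theorem (`HasExpansion.finite_zeros`).

By triangularity the functions `f_n([1; u])` are linearly independent too
(`linearIndependent_familyGerm`). The quasi-shuffle relation for `f` shows that their products are
given by the quasi-shuffle product, and that `f_n([z; u]) = ι(z) ^ (-n) f_n([1; u])`. So the
quasi-shuffle relation for `G ∘_har f` is an identity between formal combinations of words, in
which the empty word only arises as the product of empty words. Its coefficient gives a product
relation between the functions `∑_x ι(x) ^ (-n) ∑_b n ^ b G[e_0 ^ b [z / x; u]]`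
(`sum_headSeries_mul_eq`). The map `ι` is injective, because `p` does not divide `N`, so the
characters `n ↦ ι(x) ^ (-n)` can be separated (`sum_headSeries_mul_apply_eq`); since a convergent
power series determines its coefficients, so can the powers of `n`, and this is the adjoint
quasi-shuffle relation.
-/

namespace HarmonicIhara

/-! ### The fraction field of the Witt vectors -/

section Witt

variable {p : ℕ} [Fact p.Prime] {k : Type*} [Field k] {K : Type*} [NormedField K]
  [Algebra (WittVector p k) K]

theorem norm_unit_eq_one (hK : ∀ a : WittVector p k, ‖algebraMap (WittVector p k) K a‖ ≤ 1)
    (u : (WittVector p k)ˣ) : ‖algebraMap (WittVector p k) K u‖ = 1 := by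
  refine le_antisymm (hK _) ?_
  have h : ‖algebraMap (WittVector p k) K u‖ *
      ‖algebraMap (WittVector p k) K (u⁻¹ : (WittVector p k)ˣ)‖ = 1 := by
    rw [← norm_mul, ← map_mul, Units.mul_inv, map_one, norm_one]
  nlinarith [hK (u⁻¹ : (WittVector p k)ˣ), norm_nonneg (algebraMap (WittVector p k) K u)]

theorem isUltrametricDist_of_witt
    (hK : ∀ a : WittVector p k, ‖algebraMap (WittVector p k) K a‖ ≤ 1) : IsUltrametricDist K :=
  IsUltrametricDist.isUltrametricDist_of_forall_norm_natCast_le_one fun n => by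
    simpa using hK (n : WittVector p k)

theorem charZero_of_witt (hK : ∀ a : WittVector p k, ‖algebraMap (WittVector p k) K a‖ ≤ 1)
    (hp : ‖(p : K)‖ = (p : ℝ)⁻¹) : CharZero K := by
  have hpp : p.Prime := Fact.out
  have hp0 : (p : K) ≠ 0 := norm_ne_zero_iff.1 (by rw [hp]; simp [hpp.ne_zero])
  refine charZero_of_inj_zero fun n hn => by_contra fun hn0 => ?_
  obtain ⟨i, m, hm, rfl⟩ := Nat.exists_eq_pow_mul_and_not_dvd hn0 p hpp.ne_one
  have hm0 : (m : K) = 0 := by simpa [hp0] using hn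
  -- a Bézout relation between `m` and `p` exhibits `1` as a multiple of `p`, of norm less than `1`
  have hb : IsCoprime (m : ℤ) p := Nat.isCoprime_iff_coprime.2
    ((hpp.coprime_iff_not_dvd.2 hm).symm)
  obtain ⟨a, b, hab⟩ := hb
  have h1 : (b : K) * p = 1 := by
    have := congrArg (Int.cast : ℤ → K) hab
    push_cast at this
    rwa [hm0, mul_zero, zero_add] at this
  have h2 : ‖(b : K)‖ * (p : ℝ)⁻¹ = 1 := by rw [← hp, ← norm_mul, h1, norm_one]
  have h3 : ‖(b : K)‖ ≤ 1 := by simpa using hK (b : WittVector p k)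
  have h4 : (p : ℝ)⁻¹ < 1 := inv_lt_one_of_one_lt₀ (by exact_mod_cast hpp.one_lt)
  have h5 : (0 : ℝ) < (p : ℝ)⁻¹ := inv_pos.2 (by exact_mod_cast hpp.pos)
  nlinarith

variable [CharP k p] [PerfectRing k p]

/-- An element of norm at most `p ^ (-n)` is the image of a Witt vector divisible by `p ^ n`. -/
theorem exists_witt_of_norm_le [IsFractionRing (WittVector p k) K]
    (hK : ∀ a : WittVector p k, ‖algebraMap (WittVector p k) K a‖ ≤ 1)
    (hp : ‖(p : K)‖ = (p : ℝ)⁻¹) (n : ℕ) (x : K) (hx : ‖x‖ ≤ ((p : ℝ)⁻¹) ^ n) :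
    ∃ a : WittVector p k, (p : WittVector p k) ^ n ∣ a ∧ algebraMap (WittVector p k) K a = x := by
  have hp1 : (1 : ℝ) < p := by exact_mod_cast (Fact.out : p.Prime).one_lt
  have hp0 : (p : K) ≠ 0 := norm_ne_zero_iff.1 (by rw [hp]; positivity)
  obtain ⟨a, b, hb, rfl⟩ := IsFractionRing.div_surjective (A := WittVector p k) x
  by_cases ha : a = 0
  · exact ⟨0, dvd_zero _, by simp [ha]⟩
  obtain ⟨i, u, rfl⟩ := WittVector.exists_eq_pow_p_mul' a ha
  obtain ⟨j, v, rfl⟩ := WittVector.exists_eq_pow_p_mul' b (nonZeroDivisors.ne_zero hb)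
  have hij : n + j ≤ i := by
    simp only [map_mul, map_pow, map_natCast, norm_div, norm_mul, norm_pow, norm_unit_eq_one hK,
      hp, mul_one] at hx
    rw [div_le_iff₀ (by positivity), ← pow_add] at hx
    exact (pow_le_pow_iff_right_of_lt_one₀ (by positivity) (inv_lt_one_of_one_lt₀ hp1)).1 hx
  obtain ⟨l, rfl⟩ := Nat.exists_eq_add_of_le hij
  refine ⟨(p : WittVector p k) ^ n * ((p : WittVector p k) ^ l * u * (v⁻¹ : (WittVector p k)ˣ)),
    dvd_mul_right _ _, ?_⟩
  have hv : algebraMap (WittVector p k) K v ≠ 0 :=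
    norm_ne_zero_iff.1 (by rw [norm_unit_eq_one hK]; norm_num)
  have hv' : algebraMap (WittVector p k) K (v⁻¹ : (WittVector p k)ˣ) =
      (algebraMap (WittVector p k) K v)⁻¹ := by
    exact eq_inv_of_mul_eq_one_left (by rw [← map_mul, Units.inv_mul, map_one])
  simp only [map_mul, map_pow, map_natCast, hv']
  field_simp
  ring

/-- Completeness of `K`, from the `p`-adic completeness of the Witt vectors: the terms of a Cauchy
sequence that converges fast enough differ from its first term by Witt vectors. -/
theorem completeSpace_of_witt [IsFractionRing (WittVector p k) K]
    (hK : ∀ a : WittVector p k, ‖algebraMap (WittVector p k) K a‖ ≤ 1)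
    (hp : ‖(p : K)‖ = (p : ℝ)⁻¹) : CompleteSpace K := by
  have hp1 : (1 : ℝ) < p := by exact_mod_cast (Fact.out : p.Prime).one_lt
  have hq1 : (p : ℝ)⁻¹ < 1 := inv_lt_one_of_one_lt₀ hp1
  have hdvd : ∀ (n : ℕ) (a : WittVector p k), (p : WittVector p k) ^ n ∣ a →
      ‖algebraMap (WittVector p k) K a‖ ≤ ((p : ℝ)⁻¹) ^ n := by
    rintro n _ ⟨a, rfl⟩
    rw [map_mul, map_pow, map_natCast, norm_mul, norm_pow, hp]
    exact mul_le_of_le_one_right (by positivity) (hK a)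
  refine Metric.complete_of_convergent_controlled_sequences (fun n => ((p : ℝ)⁻¹) ^ n)
    (fun n => by positivity) fun u hu => ?_
  -- subtracting `u 0`, the sequence is controlled by elements of the image of the Witt vectors
  have key : ∀ n, ∃ a : WittVector p k, algebraMap (WittVector p k) K a = u n - u 0 := by
    intro n
    obtain ⟨a, -, ha⟩ := exists_witt_of_norm_le hK hp 0 (u n - u 0)
      (by simpa [dist_eq_norm] using (hu 0 n 0 (Nat.zero_le _) le_rfl).le)
    exact ⟨a, ha⟩
  choose a ha using key
  have hinj : Function.Injective (algebraMap (WittVector p k) K) := IsFractionRing.injective _ _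
  have hcong : ∀ {m n : ℕ}, m ≤ n → a m ≡ a n
      [SMOD (Ideal.span {(p : WittVector p k)} ^ m • ⊤ : Submodule (WittVector p k) _)] := by
    intro m n hmn
    rw [SModEq.sub_mem, smul_eq_mul, Ideal.mul_top, Ideal.span_singleton_pow,
      Ideal.mem_span_singleton]
    obtain ⟨c, hc, hc'⟩ := exists_witt_of_norm_le hK hp m (u m - u n)
      (by simpa [dist_eq_norm] using (hu m m n le_rfl hmn).le)
    have : c = a m - a n := hinj (by rw [hc', map_sub, ha, ha]; ring)
    exact this ▸ hc
  obtain ⟨L, hL⟩ := IsPrecomplete.prec inferInstance hcong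
  refine ⟨algebraMap (WittVector p k) K L + u 0, ?_⟩
  rw [tendsto_iff_norm_sub_tendsto_zero]
  refine squeeze_zero (fun _ => norm_nonneg _) (fun n => ?_)
    (tendsto_pow_atTop_nhds_zero_of_lt_one (by positivity) hq1)
  have h := hL n
  rw [SModEq.sub_mem, smul_eq_mul, Ideal.mul_top, Ideal.span_singleton_pow,
      Ideal.mem_span_singleton] at h
  have h2 := hdvd n _ h
  rwa [map_sub, ha, sub_sub, add_comm (u 0)] at h2

end Witt

/-- Sums of characters `n ↦ ι x ^ n` determine their coefficients. -/
theorem eq_zero_of_forall_sum_mul_pow_eq_zero {M K : Type*} [Fintype M] [Field K] {ι : M → K}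
    (hι : Function.Injective ι) (c : M → K) (h : ∀ i : ℕ, ∑ x, c x * ι x ^ i = 0) : c = 0 := by
  let e := Fintype.equivFin M
  have : c ∘ e.symm = 0 := by
    refine Matrix.eq_zero_of_forall_pow_sum_mul_pow_eq_zero (f := ι ∘ e.symm)
      (hι.comp e.symm.injective) fun i => ?_
    rw [← h i, ← e.symm.sum_comp]
    rfl
  ext x
  simpa using congrFun this (e x)

/-! ### Convergent power series on the integers -/

section Tate

variable {K : Type*} [NormedField K]

/-- `HasExpansion a f`: the function `f` on `ℤ` is `n ↦ ∑_b a_b n ^ b`. -/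
def HasExpansion (a : ℕ → K) (f : ℤ → K) : Prop :=
  ∀ n : ℤ, HasSum (fun b => a b * (n : K) ^ b) (f n)

theorem HasExpansion.tendsto_zero {a : ℕ → K} {f : ℤ → K} (h : HasExpansion a f) :
    Tendsto a atTop (𝓝 0) := by
  simpa using (h 1).summable.tendsto_atTop_zero

theorem HasExpansion.add {a b : ℕ → K} {f g : ℤ → K} (hf : HasExpansion a f)
    (hg : HasExpansion b g) : HasExpansion (a + b) (f + g) := fun n => by
  simpa [add_mul] using (hf n).add (hg n)

theorem HasExpansion.const (c : K) : HasExpansion (Pi.single 0 c) (fun _ => c) := fun n => by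
  convert! hasSum_single (f := fun b => (Pi.single 0 c : ℕ → K) b * (n : K) ^ b) 0 ?_ using 1
  · simp
  · intro b hb
    simp [Pi.single_eq_of_ne hb]

theorem HasExpansion.sum {X : Type*} (s : Finset X) {a : X → ℕ → K} {f : X → ℤ → K}
    (h : ∀ x, HasExpansion (a x) (f x)) :
    HasExpansion (fun b => ∑ x ∈ s, a x b) (fun n => ∑ x ∈ s, f x n) := fun n => by
  simpa [Finset.sum_mul] using hasSum_sum fun x (_ : x ∈ s) => h x n

theorem HasExpansion.list_sum {X : Type*} (l : List X) {a : X → ℕ → K} {f : X → ℤ → K}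
    (h : ∀ x, HasExpansion (a x) (f x)) :
    HasExpansion (fun b => (l.map fun x => a x b).sum) (fun n => (l.map fun x => f x n).sum) := by
  induction l with
  | nil => exact fun n => by simp
  | cons x l ih => exact (h x).add ih

theorem exists_uniform_bound_of_tendsto_zero {a : ℕ → K} (ha : Tendsto a atTop (𝓝 0)) (m : ℕ)
    {R : ℝ} (hR : 0 < R) (h : ∀ j, m < j → ‖a j‖ < R) :
    ∃ C, 0 ≤ C ∧ C < R ∧ ∀ j, m < j → ‖a j‖ ≤ C := by
  obtain ⟨J, hJ⟩ := Metric.tendsto_atTop.1 ha (R / 2) (by positivity)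
  obtain ⟨i, hi, hmax⟩ := Finset.exists_max_image (Finset.range (m + J + 1 + 1))
    (fun j => if m < j then ‖a j‖ else 0) ⟨0, by simp⟩
  refine ⟨max (R / 2) (if m < i then ‖a i‖ else 0), le_max_of_le_left (by positivity),
    max_lt (by linarith) ?_, fun j hj => ?_⟩
  · split_ifs with hmi
    · exact h i hmi
    · exact hR
  · rcases lt_or_ge j J with hjJ | hjJ
    · have := hmax j (Finset.mem_range.2 (by omega))
      rw [if_pos hj] at this
      exact this.trans (le_max_right _ _)
    · have := hJ j hjJ
      rw [dist_zero_right] at this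
      exact this.le.trans (le_max_left _ _)

/-- The last coefficient of maximal absolute value. -/
theorem exists_last_max {a : ℕ → K} (ha : Tendsto a atTop (𝓝 0)) (h0 : a ≠ 0) :
    ∃ m, a m ≠ 0 ∧ (∀ j, ‖a j‖ ≤ ‖a m‖) ∧ ∀ j, m < j → ‖a j‖ < ‖a m‖ := by
  obtain ⟨i, hi⟩ := Function.ne_iff.1 h0
  have hi' : 0 < ‖a i‖ := norm_pos_iff.2 hi
  obtain ⟨J, hJ⟩ := Metric.tendsto_atTop.1 ha ‖a i‖ hi'
  have hiJ : i < J := by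
    by_contra h
    simpa using hJ i (not_lt.1 h)
  obtain ⟨m, hm, hmax⟩ := Finset.exists_max_image (Finset.range J)
    (fun j => toLex (‖a j‖, j)) ⟨i, by simpa using hiJ⟩
  have hle : ∀ j < J, ‖a j‖ < ‖a m‖ ∨ ‖a j‖ = ‖a m‖ ∧ j ≤ m := fun j hj => by
    simpa [Prod.Lex.toLex_le_toLex] using hmax j (by simpa using hj)
  have him : ‖a i‖ ≤ ‖a m‖ := (hle i hiJ).elim le_of_lt fun h => h.1.le
  have hfar : ∀ j, J ≤ j → ‖a j‖ < ‖a m‖ := fun j hj => by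
    have := hJ j hj
    rw [dist_zero_right] at this
    exact this.trans_le him
  refine ⟨m, norm_pos_iff.1 (hi'.trans_le him), fun j => ?_, fun j hj => ?_⟩
  · rcases lt_or_ge j J with h | h
    · exact (hle j h).elim le_of_lt fun h => h.1.le
    · exact (hfar j h).le
  · rcases lt_or_ge j J with h | h
    · exact (hle j h).elim id fun h => absurd h.2 (not_le.2 hj)
    · exact hfar j h

variable [IsUltrametricDist K]

theorem nonarchimedeanRing : NonarchimedeanRing K :=
  ⟨NonarchimedeanAddGroup.is_nonarchimedean⟩

theorem norm_mul_intCast_pow_le (c : K) (n : ℤ) (b : ℕ) : ‖c * (n : K) ^ b‖ ≤ ‖c‖ := by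
  rw [norm_mul, norm_pow]
  exact mul_le_of_le_one_right (norm_nonneg _)
    (pow_le_one₀ (norm_nonneg _) (IsUltrametricDist.norm_intCast_le_one K n))

variable [CompleteSpace K]

theorem HasExpansion.mul {a b : ℕ → K} {f g : ℤ → K} (hf : HasExpansion a f)
    (hg : HasExpansion b g) :
    HasExpansion (fun n => ∑ kl ∈ Finset.HasAntidiagonal.antidiagonal n, a kl.1 * b kl.2)
      (f * g) := fun n => by
  have hs : Summable fun x : ℕ × ℕ => (a x.1 * (n : K) ^ x.1) * (b x.2 * (n : K) ^ x.2) := by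
    have : NonarchimedeanRing K := nonarchimedeanRing
    exact NonarchimedeanAddGroup.summable_of_tendsto_cofinite_zero
      (tendsto_mul_cofinite_nhds_zero (f := fun i => a i * (n : K) ^ i)
        (g := fun i => b i * (n : K) ^ i) (hf n).summable.tendsto_cofinite_zero
        (hg n).summable.tendsto_cofinite_zero)
  have h1 := (summable_sum_mul_antidiagonal_of_summable_mul (f := fun i => a i * (n : K) ^ i)
    (g := fun i => b i * (n : K) ^ i) hs).hasSum
  rw [← (hf n).summable.tsum_mul_tsum_eq_tsum_sum_antidiagonal (hg n).summable hs,
    (hf n).tsum_eq, (hg n).tsum_eq] at h1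
  have h2 : ∀ m, (∑ kl ∈ Finset.HasAntidiagonal.antidiagonal m, a kl.1 * b kl.2) * (n : K) ^ m =
      ∑ kl ∈ Finset.HasAntidiagonal.antidiagonal m,
        a kl.1 * (n : K) ^ kl.1 * (b kl.2 * (n : K) ^ kl.2) := fun m => by
    rw [Finset.sum_mul]
    refine Finset.sum_congr rfl fun kl hkl => ?_
    rw [← Finset.HasAntidiagonal.mem_antidiagonal.1 hkl, pow_add]
    ring
  simp only [h2]
  exact h1

theorem exists_hasExpansion {a : ℕ → K} (ha : Tendsto a atTop (𝓝 0)) :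
    ∃ f : ℤ → K, HasExpansion a f := by
  refine ⟨fun n => ∑' b, a b * (n : K) ^ b, fun n => Summable.hasSum ?_⟩
  apply NonarchimedeanAddGroup.summable_of_tendsto_cofinite_zero
  rw [Nat.cofinite_eq_atTop]
  exact squeeze_zero_norm (fun b => norm_mul_intCast_pow_le _ _ _) (by simpa using ha.norm)

/-- Re-expansion of a convergent power series at the integer `y`. -/
theorem HasExpansion.exists_shift {a : ℕ → K} {f : ℤ → K} (hf : HasExpansion a f) (y : ℤ) :
    ∃ d : ℕ → K, HasExpansion d (fun n => f (n + y)) := by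
  let c : ℕ × ℕ → K := fun x => a x.1 * ((x.1.choose x.2 : ℤ) : K) * (y : K) ^ (x.1 - x.2)
  have hc : ∀ x, ‖c x‖ ≤ ‖a x.1‖ := fun x => by
    refine (norm_mul_intCast_pow_le _ _ _).trans ?_
    simpa using norm_mul_intCast_pow_le (a x.1) (x.1.choose x.2) 1
  have hc0 : ∀ x : ℕ × ℕ, x.1 < x.2 → c x = 0 := fun x hx => by
    simp [c, Nat.choose_eq_zero_of_lt hx]
  have hsum : ∀ n : ℤ, Summable fun x : ℕ × ℕ => c x * (n : K) ^ x.2 := fun n => by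
    apply NonarchimedeanAddGroup.summable_of_tendsto_cofinite_zero
    refine squeeze_zero_norm (fun x => norm_mul_intCast_pow_le (c x) n x.2) ?_
    rw [Metric.tendsto_nhds]
    intro ε hε
    obtain ⟨B, hB⟩ := (Metric.tendsto_atTop.1 hf.tendsto_zero) ε hε
    refine ((Finset.range B ×ˢ Finset.range B).finite_toSet).subset fun x hx => ?_
    simp only [dist_zero_right, norm_norm, Set.mem_compl_iff, Set.mem_ofPred_eq, not_lt] at hx
    have h1 : x.1 < B := by
      by_contra h
      have := hB x.1 (not_lt.1 h)
      rw [dist_zero_right] at this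
      linarith [hc x]
    have h2 : x.2 ≤ x.1 := by
      by_contra h
      rw [hc0 x (not_le.1 h), norm_zero] at hx
      linarith
    simpa using ⟨h1, by omega⟩
  have hfib : ∀ j, Summable fun b => c (b, j) := fun j => by
    simpa [Function.comp_def] using
      (hsum 1).comp_injective (i := fun b : ℕ => (b, j)) (Prod.mk_left_injective j)
  refine ⟨fun j => ∑' b, c (b, j), fun n => ?_⟩
  have h1 : HasSum (fun j => (∑' b, c (b, j)) * (n : K) ^ j)
      (∑' x : ℕ × ℕ, c x * (n : K) ^ x.2) :=
    ((Equiv.prodComm ℕ ℕ).hasSum_iff.2 (hsum n).hasSum).prod_fiberwise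
      fun j => (hfib j).hasSum.mul_right _
  have h2 : HasSum (fun b => a b * ((n + y : ℤ) : K) ^ b)
      (∑' x : ℕ × ℕ, c x * (n : K) ^ x.2) := by
    refine (hsum n).hasSum.prod_fiberwise fun b => ?_
    have h3 : HasSum (fun j => c (b, j) * (n : K) ^ j)
        (∑ j ∈ Finset.range (b + 1), c (b, j) * (n : K) ^ j) :=
      hasSum_sum_of_ne_finset_zero fun j hj => by rw [hc0 (b, j) (by simpa using hj), zero_mul]
    convert h3 using 1
    rw [Int.cast_add, add_pow, Finset.mul_sum]
    exact Finset.sum_congr rfl fun j _ => by simp [c]; ring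
  rwa [h2.unique (hf (n + y))] at h1

/-- Division of `f - f(α)` by `n - α`, with the bounds on the coefficients of the quotient which
are used in Strassmann's theorem. -/
theorem HasExpansion.exists_divided {a : ℕ → K} {f : ℤ → K} (hf : HasExpansion a f) (α : ℤ) :
    ∃ (g : ℕ → K) (q : ℤ → K), HasExpansion g q ∧ (∀ n : ℤ, f n - f α = ((n : K) - α) * q n) ∧
      (∀ j C, 0 ≤ C → (∀ i, j < i → ‖a i‖ ≤ C) → ‖g j‖ ≤ C) ∧
      ∀ j, g j = a (j + 1) + α * g (j + 1) := by
  let g : ℕ → K := fun j => ∑' i, a (j + 1 + i) * (α : K) ^ i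
  have hb : ∀ j C, 0 ≤ C → (∀ i, j < i → ‖a i‖ ≤ C) → ‖g j‖ ≤ C := fun j C hC h =>
    IsUltrametricDist.norm_tsum_le_of_forall_le_of_nonneg hC fun i =>
      (norm_mul_intCast_pow_le _ _ _).trans (h _ (by omega))
  have hs : ∀ j, Summable fun i => a (j + 1 + i) * (α : K) ^ i := fun j => by
    apply NonarchimedeanAddGroup.summable_of_tendsto_cofinite_zero
    rw [Nat.cofinite_eq_atTop]
    refine squeeze_zero_norm (fun b => norm_mul_intCast_pow_le _ _ _) ?_
    have := (hf.tendsto_zero.comp (tendsto_add_atTop_nat (j + 1))).norm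
    simpa [Function.comp_def, add_comm, add_left_comm] using this
  have hrec : ∀ j, g j = a (j + 1) + α * g (j + 1) := fun j => by
    simp only [g]
    rw [(hs j).tsum_eq_zero_add, ← tsum_mul_left]
    simp only [add_zero, pow_zero, mul_one]
    congr 1
    refine tsum_congr fun i => ?_
    rw [show j + 1 + (i + 1) = j + 1 + 1 + i by ring, pow_succ]
    ring
  have hg : Tendsto g atTop (𝓝 0) := by
    rw [Metric.tendsto_atTop]
    intro ε hε
    obtain ⟨J, hJ⟩ := Metric.tendsto_atTop.1 hf.tendsto_zero (ε / 2) (by positivity)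
    refine ⟨J, fun j hj => ?_⟩
    rw [dist_zero_right]
    refine (hb j (ε / 2) (by positivity) fun i hi => ?_).trans_lt (by linarith)
    have := hJ i (by omega)
    rw [dist_zero_right] at this
    exact this.le
  obtain ⟨q, hq⟩ := exists_hasExpansion hg
  refine ⟨g, q, hq, ?_, hb, hrec⟩
  have hsucc : ∀ {c : ℕ → K} {h : ℤ → K}, HasExpansion c h → ∀ n : ℤ,
      HasSum (fun j => c (j + 1) * (n : K) ^ (j + 1)) (h n - c 0) := fun {c h} hch n => by
    have := (hasSum_nat_add_iff' 1).2 (hch n)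
    simpa using this
  -- the value of `f` in terms of `q`, from the recursion `a (j + 1) = g j - α g (j + 1)`
  have key : ∀ n : ℤ, f n = a 0 + n * q n - α * (q n - g 0) := fun n => by
    have h1 := hsucc hf n
    have h2 := ((hq n).mul_left (n : K)).sub ((hsucc hq n).mul_left (α : K))
    have h3 : (fun j => a (j + 1) * (n : K) ^ (j + 1)) = fun j =>
        (n : K) * (g j * (n : K) ^ j) - α * (g (j + 1) * (n : K) ^ (j + 1)) := by
      funext j
      rw [hrec j]
      ring
    rw [h3] at h1
    linear_combination h1.unique h2
  intro n
  linear_combination key n - key α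

variable [CharZero K]

/-- Strassmann's theorem: the number of zeros is bounded by the index of the last coefficient of
maximal absolute value, on which the induction runs. -/
theorem HasExpansion.finite_zeros_of_last_max (m : ℕ) : ∀ {a : ℕ → K} {f : ℤ → K},
    HasExpansion a f → a m ≠ 0 → (∀ j, ‖a j‖ ≤ ‖a m‖) → (∀ j, m < j → ‖a j‖ < ‖a m‖) →
    {n : ℤ | f n = 0}.Finite := by
  induction m with
  | zero =>
    intro a f hf h0 _ hlt
    obtain ⟨C, hC0, hC, hCle⟩ := exists_uniform_bound_of_tendsto_zero hf.tendsto_zero 0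
      (norm_pos_iff.2 h0) hlt
    convert Set.finite_empty
    refine Set.eq_empty_of_forall_notMem fun n (hn : f n = 0) => ?_
    have h1 := (hasSum_nat_add_iff' 1).2 (hf n)
    have h2 : ‖f n - ∑ i ∈ Finset.range 1, a i * (n : K) ^ i‖ ≤ C := by
      rw [← h1.tsum_eq]
      exact IsUltrametricDist.norm_tsum_le_of_forall_le_of_nonneg hC0 fun i =>
        (norm_mul_intCast_pow_le _ _ _).trans (hCle _ (by omega))
    simp [hn] at h2
    linarith
  | succ m ih =>
    intro a f hf h0 hle hlt
    by_cases hz : ∃ α : ℤ, f α = 0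
    · obtain ⟨α, hα⟩ := hz
      obtain ⟨g, q, hq, hfq, hb, hrec⟩ := hf.exists_divided α
      obtain ⟨C, hC0, hC, hCle⟩ := exists_uniform_bound_of_tendsto_zero hf.tendsto_zero (m + 1)
        (norm_pos_iff.2 h0) hlt
      have hgC : ∀ j, m < j → ‖g j‖ ≤ C := fun j hj =>
        hb j C hC0 fun i hi => hCle i (by omega)
      have hgm : ‖g m‖ = ‖a (m + 1)‖ := by
        have hsm : ‖(α : K) * g (m + 1)‖ < ‖a (m + 1)‖ := by
          have := norm_mul_intCast_pow_le (g (m + 1)) α 1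
          rw [pow_one, mul_comm] at this
          exact (this.trans (hgC _ (by omega))).trans_lt hC
        rw [hrec, IsUltrametricDist.norm_add_eq_max_of_norm_ne_norm hsm.ne', max_eq_left hsm.le]
      have hfin := ih hq (by rw [← norm_pos_iff, hgm]; exact norm_pos_iff.2 h0)
        (fun j => by rw [hgm]; exact hb j _ (norm_nonneg _) fun i _ => hle i)
        (fun j hj => by rw [hgm]; exact (hgC j hj).trans_lt hC)
      refine (hfin.union (Set.finite_singleton α)).subset fun n (hn : f n = 0) => ?_
      have := hfq n
      rw [hn, hα, sub_zero, eq_comm, mul_eq_zero, sub_eq_zero, Int.cast_inj] at this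
      exact this.symm
    · push Not at hz
      convert Set.finite_empty
      exact Set.eq_empty_of_forall_notMem fun n hn => hz n hn

theorem HasExpansion.finite_zeros {a : ℕ → K} {f : ℤ → K} (hf : HasExpansion a f) (h0 : f ≠ 0) :
    {n : ℤ | f n = 0}.Finite := by
  have ha : a ≠ 0 := by
    rintro rfl
    exact h0 (funext fun n => (hf n).unique (by simp))
  obtain ⟨m, h1, h2, h3⟩ := exists_last_max hf.tendsto_zero ha
  exact hf.finite_zeros_of_last_max m h1 h2 h3

theorem HasExpansion.coeff_eq_zero {a : ℕ → K} (hf : HasExpansion a 0) : a = 0 := by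
  by_contra ha
  obtain ⟨m, h1, h2, h3⟩ := exists_last_max hf.tendsto_zero ha
  exact Set.infinite_univ (by simpa using! hf.finite_zeros_of_last_max m h1 h2 h3)

theorem HasExpansion.unique {a b : ℕ → K} {f : ℤ → K} (ha : HasExpansion a f)
    (hb : HasExpansion b f) : a = b := by
  have h : HasExpansion (a - b) 0 := fun n => by
    simpa [sub_mul] using (ha n).sub (hb n)
  exact sub_eq_zero.1 h.coeff_eq_zero

end Tate

section TateAlgebra

variable (K : Type*) [NormedField K] [IsUltrametricDist K] [CompleteSpace K]

/-- The functions on `ℤ` which are given by a power series with coefficients tending to `0`. -/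
def tateAlgebra : Subalgebra K (ℤ → K) where
  carrier := {f | ∃ a, HasExpansion a f}
  mul_mem' := fun ⟨_, ha⟩ ⟨_, hb⟩ => ⟨_, ha.mul hb⟩
  add_mem' := fun ⟨_, ha⟩ ⟨_, hb⟩ => ⟨_, ha.add hb⟩
  algebraMap_mem' := fun c => ⟨_, HasExpansion.const c⟩

variable {K}

theorem mem_tateAlgebra {f : ℤ → K} : f ∈ tateAlgebra K ↔ ∃ a, HasExpansion a f := by
  change f ∈ {f | ∃ a, HasExpansion a f} ↔ _
  simp

theorem intCast_mem_tateAlgebra : (fun n : ℤ => (n : K)) ∈ tateAlgebra K := by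
  refine mem_tateAlgebra.2 ⟨Pi.single 1 1, fun n => ?_⟩
  convert! hasSum_single (f := fun b => (Pi.single 1 1 : ℕ → K) b * (n : K) ^ b) 1 ?_ using 1
  · simp
  · intro b hb
    simp [Pi.single_eq_of_ne hb]

variable (K) in
/-- The ring `tateAlgebra K`, as a type. -/
def TateRing : Type _ := tateAlgebra K

namespace TateRing

instance : CommRing (TateRing K) := inferInstanceAs (CommRing (tateAlgebra K))

instance : FunLike (TateRing K) ℤ K := ⟨Subtype.val, Subtype.val_injective⟩

theorem ext {f g : TateRing K} (h : ∀ n, f n = g n) : f = g := DFunLike.ext _ _ h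

theorem exists_hasExpansion (f : TateRing K) : ∃ a, HasExpansion a f :=
  mem_tateAlgebra.1 (Subtype.prop (p := (· ∈ tateAlgebra K)) f)

/-- The function `n ↦ ∑_b a_b n ^ b`, where `a_b` tends to `0`. -/
theorem exists_of_tendsto_zero {a : ℕ → K} (ha : Tendsto a atTop (𝓝 0)) :
    ∃ f : TateRing K, HasExpansion a f := by
  obtain ⟨f, hf⟩ := HarmonicIhara.exists_hasExpansion ha
  exact ⟨⟨f, mem_tateAlgebra.2 ⟨a, hf⟩⟩, hf⟩

/-- The values at the points `e x`. -/
def eval {β : Type*} (e : β → ℤ) : TateRing K →+* (β → K) where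
  toFun f x := f (e x)
  map_one' := rfl
  map_mul' _ _ := rfl
  map_zero' := rfl
  map_add' _ _ := rfl

/-- The constant functions. -/
def C : K →+* TateRing K where
  toFun c := ⟨fun _ => c, (tateAlgebra K).algebraMap_mem c⟩
  map_one' := rfl
  map_mul' _ _ := rfl
  map_zero' := rfl
  map_add' _ _ := rfl

/-- The function `n ↦ n`. -/
def X : TateRing K := ⟨fun n => n, intCast_mem_tateAlgebra⟩

@[simp] theorem add_apply (f g : TateRing K) (n : ℤ) : (f + g) n = f n + g n := rfl

@[simp] theorem mul_apply (f g : TateRing K) (n : ℤ) : (f * g) n = f n * g n := rfl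

@[simp] theorem zero_apply (n : ℤ) : (0 : TateRing K) n = 0 := rfl

@[simp] theorem one_apply (n : ℤ) : (1 : TateRing K) n = 1 := rfl

@[simp] theorem C_apply (c : K) (n : ℤ) : C c n = c := rfl

@[simp] theorem X_apply (n : ℤ) : (X : TateRing K) n = n := rfl

@[simp] theorem pow_apply (f : TateRing K) (m : ℕ) (n : ℤ) : (f ^ m) n = f n ^ m :=
  congrFun (map_pow (eval id) f m) n

@[simp] theorem sum_apply {α : Type*} (s : Finset α) (f : α → TateRing K) (n : ℤ) :
    (∑ i ∈ s, f i) n = ∑ i ∈ s, f i n :=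
  (congrFun (map_sum (eval id) f s) n).trans (Finset.sum_apply _ _ _)

theorem X_ne_zero : (X : TateRing K) ≠ 0 := fun h => by
  simpa using congrArg (fun f : TateRing K => f 1) h

theorem C_injective : Function.Injective (C (K := K)) := fun c d h => by
  simpa using congrArg (fun f : TateRing K => f 0) h

/-- Convergent power series are continuous for the `p`-adic topology. -/
theorem tendsto_add_pow (f : TateRing K) (x : ℤ) {p : ℕ}
    (hp : Tendsto (fun j : ℕ => ((p ^ j : ℤ) : K)) atTop (𝓝 0)) :
    Tendsto (fun j : ℕ => f (x + p ^ j)) atTop (𝓝 (f x)) := by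
  obtain ⟨a, ha⟩ := f.exists_hasExpansion
  obtain ⟨g, q, hq, hfq, hb, -⟩ := ha.exists_divided x
  obtain ⟨C, hC0, hC⟩ : ∃ C, 0 ≤ C ∧ ∀ i, ‖g i‖ ≤ C := by
    obtain ⟨C, hC⟩ := (hq.tendsto_zero.norm).bddAbove_range
    exact ⟨C, (norm_nonneg _).trans (hC ⟨0, rfl⟩), fun i => hC ⟨i, rfl⟩⟩
  have hqC : ∀ n, ‖q n‖ ≤ C := fun n => by
    rw [← (hq n).tsum_eq]
    exact IsUltrametricDist.norm_tsum_le_of_forall_le_of_nonneg hC0 fun i =>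
      (norm_mul_intCast_pow_le _ _ _).trans (hC i)
  rw [tendsto_iff_norm_sub_tendsto_zero]
  refine squeeze_zero (fun _ => norm_nonneg _) (fun j => ?_) (g := fun j =>
    ‖((p ^ j : ℤ) : K)‖ * C) (by simpa using hp.norm.mul_const C)
  rw [hfq, norm_mul]
  have : (((x + (p : ℤ) ^ j : ℤ) : K) - x) = ((p ^ j : ℤ) : K) := by push_cast; ring
  rw [this]
  exact mul_le_mul_of_nonneg_left (hqC _) (norm_nonneg _)

/-- The shift `f ↦ f(· + y)`. -/
def shift (y : ℤ) : TateRing K →+* TateRing K where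
  toFun f := ⟨fun n => f (n + y), by
    obtain ⟨a, ha⟩ := f.exists_hasExpansion
    exact mem_tateAlgebra.2 (ha.exists_shift y)⟩
  map_one' := rfl
  map_mul' _ _ := rfl
  map_zero' := rfl
  map_add' _ _ := rfl

@[simp] theorem shift_apply (y : ℤ) (f : TateRing K) (n : ℤ) : shift y f n = f (n + y) := rfl

theorem shift_injective (y : ℤ) : Function.Injective (shift (K := K) y) := fun f g h =>
  ext fun n => by simpa using congrArg (fun f : TateRing K => f (n - y)) h

variable [CharZero K]

theorem finite_zeros {f : TateRing K} (h0 : f ≠ 0) : {n : ℤ | f n = 0}.Finite := by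
  obtain ⟨a, ha⟩ := f.exists_hasExpansion
  exact ha.finite_zeros fun h => h0 (DFunLike.coe_injective h)

instance : IsDomain (TateRing K) := by
  have : Nontrivial (TateRing K) := C_injective.nontrivial
  have : NoZeroDivisors (TateRing K) := ⟨fun {f g} hfg => by
    by_contra! h
    refine Set.infinite_univ (α := ℤ) (((finite_zeros h.1).union
      (finite_zeros h.2)).subset fun n _ => ?_)
    have : f n * g n = 0 := congrArg (fun f : TateRing K => f n) hfg
    exact mul_eq_zero.1 this⟩
  exact NoZeroDivisors.to_isDomain _

end TateRing

end TateAlgebra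

/-! ### Linear independence of iterated sums over a difference field -/

section DifferenceField

variable {L A X : Type*} [Field L] [CommRing A] [Algebra L A]

/-- The free-module form of a unitriangularity condition: an element of `t • S u + span {S w}`,
`w` shorter than `u`, is the image of an explicit formal combination. -/
theorem exists_linearCombination_eq {S : List X → A} {u : List X} {t : L} {a : A}
    (h : a - t • S u ∈ Submodule.span L (S '' {w | w.length < u.length})) :
    ∃ D : List X →₀ L, Finsupp.linearCombination L S D = a ∧ D u = t ∧
      ∀ w, w ≠ u → u.length ≤ w.length → D w = 0 := by
  classical
  obtain ⟨l, hl, hl'⟩ := (Finsupp.mem_span_image_iff_linearCombination L).1 h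
  have hl0 : ∀ w, u.length ≤ w.length → l w = 0 := fun w hw => by
    by_contra h0
    have := (Finsupp.mem_supported L l).1 hl (Finsupp.mem_support_iff.2 h0)
    exact absurd this (by simpa using hw)
  refine ⟨l + Finsupp.single u t, ?_, ?_, fun w hw hlen => ?_⟩
  · rw [map_add, hl', Finsupp.linearCombination_single, sub_add_cancel]
  · simp [hl0 u le_rfl]
  · simp [hl0 w hlen, Finsupp.single_eq_of_ne hw]

/-- A family obtained from a linearly independent family, indexed by words, by a triangular
change with respect to the length of words is linearly independent. -/
theorem linearIndependent_of_triangular {S F : List X → A} (hS : LinearIndependent L S)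
    {t : List X → L} (ht : ∀ u, t u ≠ 0)
    (h : ∀ u, F u - t u • S u ∈ Submodule.span L (S '' {w | w.length < u.length})) :
    LinearIndependent L F := by
  choose D hD hDu hDw using fun u => exists_linearCombination_eq (h u)
  rw [linearIndependent_iff]
  intro c hc
  by_contra hne
  obtain ⟨u, hu, hmax⟩ := Finset.exists_max_image c.support List.length
    (Finsupp.support_nonempty_iff.2 hne)
  have h0 : c.sum (fun y a => a • D y) = 0 := by
    refine linearIndependent_iff.1 hS _ ?_
    rw [← hc, map_finsuppSum, Finsupp.linearCombination_apply]
    simp only [map_smul, hD]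
  have h1 := DFunLike.congr_fun h0 u
  rw [Finsupp.sum, Finsupp.finsetSum_apply, Finset.sum_eq_single u] at h1
  · simp only [Finsupp.smul_apply, hDu, smul_eq_mul, Finsupp.coe_zero, Pi.zero_apply,
      mul_eq_zero] at h1
    exact h1.elim (Finsupp.mem_support_iff.1 hu) (ht u)
  · intro y hy hyu
    rw [Finsupp.smul_apply, hDw y u hyu.symm (hmax y hy), smul_zero]
  · exact fun h => absurd hu h

variable [Nontrivial A]

/-- Iterated sums `S`, indexed by words, whose differences satisfy
`σ (S (x :: u)) - S (x :: u) = T x • S u + ⋯` up to shorter words, are linearly independent over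
the difference field `L` as soon as no nontrivial combination of the `T x` with invariant
coefficients is a difference. Given a relation with as few words of maximal length as possible
and with one of their coefficients equal to `1`, its difference is a smaller relation, hence is
trivial; so the leading coefficients are invariant, and the coefficients in length one less
exhibit a combination of the `T x` as a difference. -/
theorem linearIndependent_of_difference (τ : L →+* L) (σ : A →+* A)
    (hσ : ∀ q, σ (algebraMap L A q) = algebraMap L A (τ q)) (S : List X → A) (T : X → L)
    (hS0 : S [] = 1)
    (hS : ∀ x u, σ (S (x :: u)) - S (x :: u) - T x • S u ∈
      Submodule.span L (S '' {w | w.length < u.length}))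
    (hT : ∀ (l : X →₀ L) (q : L), (∀ x, τ (l x) = l x) →
      l.sum (fun x a => a * T x) = τ q - q → l = 0) :
    LinearIndependent L S := by
  classical
  have hσS : ∀ (a : L) (b : A), σ (a • b) = τ a • σ b := fun a b => by
    rw [Algebra.smul_def, map_mul, hσ, ← Algebra.smul_def]
  -- the difference of `S y` as a formal combination
  obtain ⟨D, hD, hDcons, hDlen⟩ : ∃ D : List X → (List X →₀ L),
      (∀ y, Finsupp.linearCombination L S (D y) = σ (S y) - S y) ∧
      (∀ x u, D (x :: u) u = T x) ∧
      ∀ y w, y.length ≤ w.length + 1 → (∀ x, y ≠ x :: w) → D y w = 0 := by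
    choose D hD hDu hDw using fun x u => exists_linearCombination_eq (hS x u)
    refine ⟨fun y => match y with
      | [] => 0
      | x :: u => D x u, fun y => ?_, fun x u => hDu x u, fun y w hlen hne => ?_⟩
    · cases y with
      | nil => simp [hS0]
      | cons x u => exact hD x u
    · cases y with
      | nil => rfl
      | cons x u =>
        refine hDw x u w ?_ (by simpa using hlen)
        rintro rfl
        exact hne x rfl
  suffices key : ∀ d, ∀ c : List X →₀ L, (∀ u ∈ c.support, u.length < d) →
      Finsupp.linearCombination L S c = 0 → c = 0 by
    rw [linearIndependent_iff]
    intro c hc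
    refine key (c.support.sup List.length + 1) c (fun u hu => ?_) hc
    exact Nat.lt_succ_of_le (Finset.le_sup (f := List.length) hu)
  intro d
  induction d with
  | zero =>
    intro c hc _
    rw [← Finsupp.support_eq_empty, Finset.eq_empty_iff_forall_notMem]
    exact fun u hu => absurd (hc u hu) (Nat.not_lt_zero _)
  | succ d ihd =>
    intro c
    induction hn : (c.support.filter fun u => u.length = d).card using Nat.strong_induction_on
      generalizing c with
    | _ n ihn =>
    intro hlen hc
    by_cases htop : ∃ u ∈ c.support, u.length = d
    swap
    · push Not at htop
      exact ihd c (fun u hu => lt_of_le_of_ne (Nat.le_of_lt_succ (hlen u hu)) (htop u hu)) hc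
    exfalso
    obtain ⟨u₀, hu₀, hu₀d⟩ := htop
    have hcu : c u₀ ≠ 0 := Finsupp.mem_support_iff.1 hu₀
    obtain ⟨e, he, hesupp, he1⟩ : ∃ e : List X →₀ L, Finsupp.linearCombination L S e = 0 ∧
        e.support = c.support ∧ e u₀ = 1 :=
      ⟨(c u₀)⁻¹ • c, by rw [map_smul, hc, smul_zero],
        Finsupp.support_smul_eq (inv_ne_zero hcu), by simp [hcu]⟩
    have helen : ∀ u ∈ e.support, u.length ≤ d := fun u hu =>
      Nat.le_of_lt_succ (hlen u (hesupp ▸ hu))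
    let e' : List X →₀ L := (e.mapRange τ (map_zero τ) - e) + e.sum fun y a => τ a • D y
    have he'0 : Finsupp.linearCombination L S e' = 0 := by
      have h1 : Finsupp.linearCombination L S (e.mapRange τ (map_zero τ)) =
          e.sum fun y a => τ a • S y := by
        rw [Finsupp.linearCombination_apply, Finsupp.sum_mapRange_index (by simp)]
      have h2 : Finsupp.linearCombination L S (e.sum fun y a => τ a • D y) =
          (e.sum fun y a => τ a • σ (S y)) - e.sum fun y a => τ a • S y := by
        rw [map_finsuppSum, ← Finsupp.sum_sub]
        simp only [map_smul, hD, smul_sub]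
      have h3 : (e.sum fun y a => τ a • σ (S y)) = 0 := by
        rw [← map_zero σ, ← he, Finsupp.linearCombination_apply, map_finsuppSum]
        simp only [hσS]
      rw [map_add, map_sub, h1, h2, he, h3]
      ring
    have he'apply : ∀ w, e' w = τ (e w) - e w + ∑ y ∈ e.support, τ (e y) * D y w := fun w => by
      simp [e', Finsupp.sum]
    have he'top : ∀ w, d ≤ w.length → e' w = τ (e w) - e w := fun w hw => by
      rw [he'apply, Finset.sum_eq_zero, add_zero]
      intro y hy
      rw [hDlen y w ((helen y hy).trans (hw.trans (Nat.le_succ _))), mul_zero]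
      rintro x rfl
      have := helen _ hy
      rw [List.length_cons] at this
      omega
    have he'supp : ∀ w ∈ e'.support, d ≤ w.length → w ∈ e.support := fun w hw hdw => by
      rw [Finsupp.mem_support_iff] at hw ⊢
      intro h
      rw [he'top w hdw, h, map_zero, sub_zero] at hw
      exact hw rfl
    have he' : e' = 0 := by
      refine ihn _ ?_ e' rfl (fun u hu => ?_) he'0
      · rw [← hn]
        refine Finset.card_lt_card (Finset.ssubset_iff_of_subset (fun w hw => ?_) |>.2
          ⟨u₀, by simp [hu₀d, hcu], fun h => ?_⟩)
        · rw [Finset.mem_filter] at hw ⊢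
          exact ⟨hesupp ▸ he'supp w hw.1 hw.2.ge, hw.2⟩
        · rw [Finset.mem_filter, Finsupp.mem_support_iff, he'top u₀ hu₀d.ge, he1] at h
          simp at h
      · by_contra h
        have := helen u (he'supp u hu (by omega))
        omega
    have hinv : ∀ w, w.length = d → τ (e w) = e w := fun w hw => by
      have := he'top w hw.ge
      rwa [he', Finsupp.zero_apply, eq_comm, sub_eq_zero] at this
    cases u₀ with
    | nil =>
      have hes : e = Finsupp.single [] 1 := by
        ext w
        by_cases hw : w = []
        · rw [hw, he1, Finsupp.single_eq_same]
        · rw [Finsupp.single_eq_of_ne hw]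
          by_contra h
          have := helen w (Finsupp.mem_support_iff.2 h)
          rw [← hu₀d, List.length_nil, Nat.le_zero, List.length_eq_zero_iff] at this
          exact hw this
      rw [hes, Finsupp.linearCombination_single, one_smul, hS0] at he
      exact one_ne_zero he
    | cons x₀ v =>
      let l : X →₀ L := e.comapDomain (· :: v) (fun x _ y _ h => (List.cons.inj h).1)
      have hvd : v.length + 1 = d := by simpa using hu₀d
      have hl : ∀ x, l x = e (x :: v) := fun x => rfl
      have hlinv : ∀ x, τ (l x) = l x := fun x => hinv _ (by simpa using hvd)
      have hsum : ∑ y ∈ e.support, τ (e y) * D y v = l.sum fun x a => a * T x := by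
        refine (Finset.sum_of_injOn (· :: v) (fun x _ y _ h => (List.cons.inj h).1)
          (fun x hx => ?_) (fun y hy hyv => ?_) (fun x hx => ?_)).symm
        · have : l x ≠ 0 := by simpa using hx
          simpa [← hl] using this
        · rw [hDlen y v (hvd ▸ helen y hy), mul_zero]
          rintro x rfl
          exact hyv ⟨x, by simpa [hl] using hy, rfl⟩
        · rw [hDcons, ← hl, hlinv]
      have h0 := he'apply v
      rw [he', hsum, Finsupp.zero_apply] at h0
      have hl0 := hT l (-e v) hlinv (by rw [map_neg]; linear_combination -h0)
      have := DFunLike.congr_fun hl0 x₀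
      rw [hl, he1] at this
      exact one_ne_zero this

end DifferenceField

/-! ### Differences of meromorphic functions on the integers -/

section Meromorphic

variable (K : Type*) [NormedField K] [IsUltrametricDist K] [CompleteSpace K] [CharZero K]

/-- The field of fractions of `TateRing K`. -/
def TateField := FractionRing (TateRing K)

noncomputable instance : Field (TateField K) := inferInstanceAs (Field (FractionRing (TateRing K)))

noncomputable instance : Algebra (TateRing K) (TateField K) :=
  inferInstanceAs (Algebra (TateRing K) (FractionRing (TateRing K)))

instance : IsFractionRing (TateRing K) (TateField K) :=
  inferInstanceAs (IsFractionRing (TateRing K) (FractionRing (TateRing K)))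

variable {K} {β : Type*} {l : Filter β} {e : β → ℤ}

theorem eventually_ne_zero (he : Tendsto e l cofinite) {f : TateRing K} (hf : f ≠ 0) :
    ∀ᶠ x in l, f (e x) ≠ 0 :=
  he.eventually (TateRing.finite_zeros hf).eventually_cofinite_notMem

theorem isUnit_germ_eval (he : Tendsto e l cofinite) {f : TateRing K} (hf : f ≠ 0) :
    IsUnit (Germ.coeRingHom l (TateRing.eval e f)) := by
  refine IsUnit.of_mul_eq_one (Germ.coeRingHom l (fun x => (f (e x))⁻¹)) ?_
  rw [← map_mul, ← map_one (Germ.coeRingHom l)]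
  refine Germ.coe_eq.2 ?_
  filter_upwards [eventually_ne_zero he hf] with x hx
  exact mul_inv_cancel₀ hx

/-- The germs of the elements of `TateField K` along a map `e` which tends to the cofinite filter,
so that denominators have finitely many zeros on its range. -/
noncomputable def evalHom (he : Tendsto e l cofinite) : TateField K →+* Germ l K :=
  IsLocalization.lift (M := nonZeroDivisors (TateRing K))
    (g := (Germ.coeRingHom l).comp (TateRing.eval e))
    fun f => isUnit_germ_eval he (nonZeroDivisors.ne_zero f.2)

theorem evalHom_algebraMap (he : Tendsto e l cofinite) (f : TateRing K) :
    evalHom he (algebraMap _ _ f) = ((fun x => f (e x) : β → K) : Germ l K) :=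
  IsLocalization.lift_eq _ f

theorem evalHom_div (he : Tendsto e l cofinite) (f g : TateRing K) (hg : g ≠ 0) :
    evalHom he (algebraMap _ _ f / algebraMap _ _ g) =
      ((fun x => f (e x) / g (e x) : β → K) : Germ l K) := by
  refine (isUnit_germ_eval he hg).mul_right_cancel ?_
  have h1 : Germ.coeRingHom l (TateRing.eval e g) = evalHom he (algebraMap _ _ g) :=
    (evalHom_algebraMap he g).symm
  have hg' : algebraMap (TateRing K) (TateField K) g ≠ 0 := by simpa using hg
  conv_lhs => rw [h1, ← map_mul, div_mul_cancel₀ _ hg', evalHom_algebraMap]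
  refine Germ.coe_eq.2 ?_
  filter_upwards [eventually_ne_zero he hg] with x hx
  exact (div_mul_cancel₀ _ hx).symm

/-- The shift `q ↦ q(· + y)` of the field `TateField K`. -/
noncomputable def fieldShift (y : ℤ) : TateField K →+* TateField K :=
  IsFractionRing.map (TateRing.shift_injective (K := K) y)

theorem fieldShift_algebraMap (y : ℤ) (f : TateRing K) :
    fieldShift y (algebraMap _ (TateField K) f) = algebraMap _ _ (TateRing.shift y f) := by
  rw [fieldShift, IsFractionRing.map]
  exact IsLocalization.map_eq _ f

theorem evalHom_fieldShift (he : Tendsto e l cofinite) {y : ℤ}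
    (he' : Tendsto (fun x => e x + y) l cofinite) (q : TateField K) :
    evalHom he (fieldShift y q) = evalHom he' q := by
  have : (evalHom (K := K) he).comp (fieldShift y) = evalHom he' := by
    refine IsLocalization.ringHom_ext (nonZeroDivisors (TateRing K)) ?_
    ext f
    simp only [RingHom.comp_apply, fieldShift_algebraMap, evalHom_algebraMap, TateRing.shift_apply]
  exact congrArg (fun φ => φ q) this

/-- The rational function `1 / (n + i)`. -/
noncomputable def invLinear (K : Type*) [NormedField K] [IsUltrametricDist K] [CompleteSpace K]
    [CharZero K] (i : ℤ) : TateField K :=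
  (algebraMap (TateRing K) _ (TateRing.X + TateRing.C (i : K)))⁻¹

theorem evalHom_invLinear (he : Tendsto e l cofinite) (i : ℤ) :
    evalHom he (invLinear K i) = ((fun x => 1 / ((e x + i : ℤ) : K) : β → K) : Germ l K) := by
  have h0 : (TateRing.X + TateRing.C (i : K) : TateRing K) ≠ 0 := fun h => by
    simpa [-map_intCast, -eq_intCast] using congrArg (fun f : TateRing K => f (1 - i)) h
  have := evalHom_div he 1 _ h0
  rw [map_one, one_div] at this
  rw [invLinear, this]
  simp [-map_intCast, -eq_intCast]

/-- Let `a / b` be a quotient of two convergent power series whose difference over `N` steps is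
`∑_{i < N} P_i(1 / (n + i))`, where the `P_i` have no constant term. Then the `P_i` vanish:
otherwise `a / b` has a pole, which propagates along its class modulo `N` to infinity in at
least one of the two directions, whereas `b` has finitely many zeros. The poles `x` are detected by
the unboundedness of the values at `x + p ^ j`, `j → ∞`. -/
theorem eq_zero_of_difference {p : ℕ} (hp0 : p ≠ 0)
    (hp : Tendsto (fun j : ℕ => ((p ^ j : ℤ) : K)) atTop (𝓝 0))
    (N : ℕ) [NeZero N] (a b : TateRing K) (hb : b ≠ 0) (P : ℕ → Polynomial K)
    (hP0 : ∀ i < N, (P i).coeff 0 = 0)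
    (h : ∀ᶠ n : ℤ in cofinite, a (n + N) / b (n + N) - a n / b n =
      ∑ i ∈ Finset.range N, (P i).eval (1 / ((n + i : ℤ) : K))) :
    ∀ i < N, P i = 0 := by
  have hN : 0 < N := Nat.pos_of_ne_zero (NeZero.ne N)
  let q : ℤ → K := fun n => a n / b n
  let Bdd : (ℕ → K) → Prop := fun u => IsBoundedUnder (· ≤ ·) atTop fun j => ‖u j‖
  let E : ℕ → ℤ → K := fun i n => (P i).eval (1 / ((n + i : ℤ) : K))
  have bdd_of_tendsto : ∀ {u : ℕ → K} {c : K}, Tendsto u atTop (𝓝 c) → Bdd u :=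
    fun hu => hu.norm.isBoundedUnder_le
  have bdd_add : ∀ {u v : ℕ → K}, Bdd u → Bdd v → Bdd fun j => u j + v j := by
    rintro u v ⟨C, hC⟩ ⟨D, hD⟩
    refine ⟨C + D, ?_⟩
    rw [eventually_map] at hC hD ⊢
    filter_upwards [hC, hD] with j h1 h2
    exact (norm_add_le _ _).trans (add_le_add h1 h2)
  have bdd_neg : ∀ {u : ℕ → K}, Bdd u → Bdd fun j => - u j := fun hu => by
    simpa [Bdd] using hu
  have bdd_sum : ∀ (s : Finset ℕ) (u : ℕ → ℕ → K), (∀ i ∈ s, Bdd (u i)) →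
      Bdd fun j => ∑ i ∈ s, u i j := by
    intro s u
    induction s using Finset.cons_induction with
    | empty => exact fun _ => by simpa using! bdd_of_tendsto (tendsto_const_nhds (x := (0 : K)))
    | cons i s his ih =>
      intro hs
      simp only [Finset.sum_cons]
      exact bdd_add (hs i (Finset.mem_cons_self i s))
        (ih fun i hi => hs i (Finset.mem_cons_of_mem hi))
  have bdd_congr : ∀ {u v : ℕ → K}, u =ᶠ[atTop] v → Bdd u → Bdd v := by
    rintro u v huv ⟨C, hC⟩
    refine ⟨C, ?_⟩
    rw [eventually_map] at hC ⊢
    filter_upwards [hC, huv] with j h1 h2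
    rwa [← h2]
  -- the sequence `x + p ^ j` approaches `x`, and avoids finite sets
  have hinj : ∀ x : ℤ, Tendsto (fun j : ℕ => x + (p : ℤ) ^ j) atTop cofinite := by
    intro x
    by_cases hp1 : p = 1
    · exfalso
      simp only [hp1, Nat.cast_one, one_pow, Int.cast_one] at hp
      exact one_ne_zero (tendsto_nhds_unique tendsto_const_nhds hp)
    · rw [← Nat.cofinite_eq_atTop]
      refine Function.Injective.tendsto_cofinite fun i j hij => ?_
      have : p ^ i = p ^ j := by exact_mod_cast add_left_cancel hij
      exact Nat.pow_right_injective (by omega) this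
  -- `x` is not a pole of `a / b`
  let Reg : ℤ → Prop := fun x => Bdd fun j => q (x + p ^ j)
  have hfin : {x | ¬ Reg x}.Finite := by
    refine (TateRing.finite_zeros hb).subset fun x hx => ?_
    by_contra hbx
    exact hx (bdd_of_tendsto ((a.tendsto_add_pow x hp).div
      (b.tendsto_add_pow x hp) hbx))
  have hE : ∀ (i : ℕ) (x : ℤ), x + i ≠ 0 → Bdd fun j => E i (x + p ^ j) := by
    intro i x hx
    have h1 : Tendsto (fun j : ℕ => 1 / ((x + p ^ j + i : ℤ) : K)) atTop
        (𝓝 (1 / ((x + i : ℤ) : K))) := by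
      refine Tendsto.div tendsto_const_nhds ?_ (by exact_mod_cast hx)
      have := hp.const_add ((x + i : ℤ) : K)
      rw [add_zero] at this
      refine this.congr fun j => ?_
      push_cast
      ring
    exact bdd_of_tendsto (((P i).continuous.tendsto _).comp h1)
  have hid : ∀ x : ℤ, (fun j : ℕ => q (x + N + p ^ j) - q (x + p ^ j)) =ᶠ[atTop]
      fun j => ∑ i ∈ Finset.range N, E i (x + p ^ j) := fun x => by
    filter_upwards [(hinj x).eventually h] with j hj
    rw [add_right_comm]
    exact hj
  have hstep : ∀ x : ℤ, (∀ i < N, x + i ≠ 0) → (Reg x ↔ Reg (x + N)) := by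
    intro x hx
    have hB := bdd_congr (hid x).symm
      (bdd_sum (Finset.range N) (fun i j => E i (x + p ^ j)) fun i hi =>
        hE i x (hx i (Finset.mem_range.1 hi)))
    constructor
    · intro h1
      refine bdd_congr (.of_eq (funext fun j => ?_)) (bdd_add hB h1)
      simp
    · intro h1
      refine bdd_congr (.of_eq (funext fun j => ?_)) (bdd_add (bdd_neg hB) h1)
      simp
  intro i₀ hi₀
  by_contra hPi
  have hdeg : 0 < (P i₀).degree := by
    by_contra hdeg
    have hC := Polynomial.eq_C_of_degree_le_zero (not_lt.1 hdeg)
    rw [hP0 i₀ hi₀, map_zero] at hC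
    exact hPi hC
  -- the term of index `i₀` has a pole at `-i₀`, and it is the only one
  have hunb : ¬ Bdd fun j => E i₀ (-i₀ + p ^ j) := by
    intro hB
    have h1 : Tendsto (fun j : ℕ => ‖E i₀ (-i₀ + p ^ j)‖) atTop atTop := by
      refine (P i₀).tendsto_norm_atTop hdeg (z := fun j : ℕ => 1 / ((-i₀ + p ^ j + i₀ : ℤ) : K)) ?_
      have h2 : Tendsto (fun j : ℕ => ‖((p ^ j : ℤ) : K)‖) atTop (𝓝[>] 0) := by
        refine tendsto_nhdsWithin_iff.2 ⟨by simpa using hp.norm, .of_forall fun j => ?_⟩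
        exact norm_pos_iff.2 (by exact_mod_cast pow_ne_zero j hp0)
      refine (tendsto_inv_nhdsGT_zero.comp h2).congr fun j => ?_
      rw [Function.comp_apply, ← norm_inv, one_div]
      congr 3
      ring
    exact not_isBoundedUnder_of_tendsto_atTop h1 hB
  -- so one of the two ends of the step from `-i₀` to `-i₀ + N` is a pole of `a / b`
  have hor : ¬ Reg (-i₀) ∨ ¬ Reg (-i₀ + N) := by
    by_contra! hreg
    refine hunb ?_
    have h1 := bdd_congr (hid (-i₀)) (by
      simpa only [sub_eq_add_neg] using bdd_add hreg.2 (bdd_neg hreg.1))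
    have h2 := bdd_sum ((Finset.range N).erase i₀) (fun i j => E i (-i₀ + p ^ j)) fun i hi => by
      refine hE i _ ?_
      have := Finset.ne_of_mem_erase hi
      omega
    refine bdd_congr (.of_eq (funext fun j => ?_)) (bdd_add h1 (bdd_neg h2))
    rw [← Finset.add_sum_erase _ _ (Finset.mem_range.2 hi₀)]
    ring
  rcases hor with h1 | h1
  · have h2 : ∀ m : ℕ, ¬ Reg (-i₀ - m * N) := by
      intro m
      induction m with
      | zero => simpa using h1
      | succ m ih =>
        rw [hstep _ fun i hi => ?_]
        · convert ih using 2
          push_cast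
          ring
        · push_cast
          nlinarith
    refine Set.infinite_of_injective_forall_mem (f := fun m : ℕ => -(i₀ : ℤ) - m * N) ?_ h2 hfin
    intro m m' hmm
    have : (m : ℤ) * N = m' * N := by simpa using hmm
    exact_mod_cast mul_right_cancel₀ (by exact_mod_cast hN.ne') this
  · have h2 : ∀ m : ℕ, ¬ Reg (-i₀ + N + m * N) := by
      intro m
      induction m with
      | zero => simpa using h1
      | succ m ih =>
        rw [hstep _ fun i hi => ?_] at ih
        · convert ih using 2
          push_cast
          ring
        · nlinarith
    refine Set.infinite_of_injective_forall_mem (f := fun m : ℕ => -(i₀ : ℤ) + N + m * N) ?_ h2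
      hfin
    intro m m' hmm
    have : (m : ℤ) * N = m' * N := by simpa using hmm
    exact_mod_cast mul_right_cancel₀ (by exact_mod_cast hN.ne') this

end Meromorphic

/-! ### Linear independence of multiple harmonic sums -/

section NestedSums

variable {M K : Type*} [CommGroup M] [NormedField K]

/-- The sum over `0 < n_1 < ⋯ < n_d < n` of `ε_1 ^ n_1 ⋯ ε_d ^ n_d / (n_1 ^ s_1 ⋯ n_d ^ s_d)`, for
the word `[(s_d, ε_d), …, (s_1, ε_1)]`. -/
def ratioSum (ι : M →* K) : ℕ → List (ℕ+ × M) → K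
  | _, [] => 1
  | n, x :: u => ∑ m ∈ Finset.Ioo 0 n, ι x.2 ^ m / (m : K) ^ (x.1 : ℕ) * ratioSum ι m u

theorem nestedSum_ofRatiosAux (ι : M →* K) (n : ℕ) (z : M) (u : List (ℕ+ × M)) :
    nestedSum ι n z (ofRatiosAux z u) = ratioSum ι n u := by
  induction u generalizing n z with
  | nil => simp [ofRatiosAux, nestedSum, ratioSum]
  | cons x u ih =>
    obtain ⟨s, ε⟩ := x
    have hz : ι z / ι (z / ε) = ι ε := by
      have h1 : ι z ≠ 0 := ((Group.isUnit z).map ι).ne_zero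
      have h2 : ι (z / ε) ≠ 0 := ((Group.isUnit (z / ε)).map ι).ne_zero
      rw [div_eq_iff h2, ← map_mul, mul_div_cancel]
    simp only [ofRatiosAux, nestedSum, ratioSum, ih, hz]

theorem ratioSum_succ (ι : M →* K) (n : ℕ) (x : ℕ+ × M) (u : List (ℕ+ × M)) :
    ratioSum ι (n + 1) (x :: u) =
      ratioSum ι n (x :: u) + ι x.2 ^ n / (n : K) ^ (x.1 : ℕ) * ratioSum ι n u := by
  rcases Nat.eq_zero_or_pos n with rfl | hn
  · simp [ratioSum, show Finset.Ioo 0 1 = ∅ from rfl]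
  · have : Finset.Ioo 0 (n + 1) = insert n (Finset.Ioo 0 n) := by
      ext m
      simp only [Finset.mem_Ioo, Finset.mem_insert]
      omega
    rw [ratioSum, this, Finset.sum_insert (by simp), add_comm, ratioSum]

end NestedSums

section Germs

variable (K : Type*) [NormedField K]

/-- The ring of germs at infinity of functions on the class of `n₀` modulo `N`, parametrized by
`m ↦ n₀ + N m`. -/
def ClassGerm (_N _n₀ : ℕ) : Type _ := Germ (atTop : Filter ℕ) K

variable (N n₀ : ℕ)

noncomputable instance : CommRing (ClassGerm K N n₀) :=
  inferInstanceAs (CommRing (Germ (atTop : Filter ℕ) K))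

instance : Nontrivial (ClassGerm K N n₀) :=
  inferInstanceAs (Nontrivial (Germ (atTop : Filter ℕ) K))

variable {K}

/-- The germ of a function on `ℕ`. -/
noncomputable def ClassGerm.of : (ℕ → K) →+* ClassGerm K N n₀ :=
  (Germ.coeRingHom atTop).comp
    { toFun := fun f m => f (n₀ + N * m)
      map_one' := rfl
      map_mul' := fun _ _ => rfl
      map_zero' := rfl
      map_add' := fun _ _ => rfl }

variable {N n₀}

theorem ClassGerm.of_eq_of {f g : ℕ → K} :
    ClassGerm.of N n₀ f = ClassGerm.of N n₀ g ↔
      ∀ᶠ m : ℕ in atTop, f (n₀ + N * m) = g (n₀ + N * m) := Germ.coe_eq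

theorem ClassGerm.exists_of [NeZero N] (a : ClassGerm K N n₀) : ∃ f, ClassGerm.of N n₀ f = a := by
  induction a using Germ.inductionOn with
  | h f =>
    refine ⟨fun n => f ((n - n₀) / N),
      congrArg (fun g : ℕ → K => (g : Germ (atTop : Filter ℕ) K)) (funext fun m => ?_)⟩
    simp [Nat.mul_div_cancel_left m (Nat.pos_of_ne_zero (NeZero.ne N))]

/-- The shift `n ↦ n + N`. -/
noncomputable def ClassGerm.shift : ClassGerm K N n₀ →+* ClassGerm K N n₀ where
  toFun a := Germ.compTendsto (a : Germ (atTop : Filter ℕ) K) (fun m => m + 1)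
    (tendsto_add_atTop_nat 1)
  map_one' := rfl
  map_mul' a b := by
    induction a using Germ.inductionOn with
    | h f =>
      induction b using Germ.inductionOn with
      | h g => rfl
  map_zero' := rfl
  map_add' a b := by
    induction a using Germ.inductionOn with
    | h f =>
      induction b using Germ.inductionOn with
      | h g => rfl

theorem ClassGerm.shift_of (f : ℕ → K) :
    ClassGerm.shift (ClassGerm.of N n₀ f) = ClassGerm.of N n₀ fun n => f (n + N) := by
  refine congrArg (fun g : ℕ → K => (g : Germ (atTop : Filter ℕ) K)) (funext fun m => ?_)
  change f (n₀ + N * (m + 1)) = f (n₀ + N * m + N)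
  congr 1
  ring

end Germs

section Independence

variable {K : Type*} [NormedField K] [IsUltrametricDist K] [CompleteSpace K] [CharZero K]
  {N : ℕ} [NeZero N] {n₀ : ℕ}

variable (N n₀) in
theorem tendsto_class_cofinite (y : ℤ) :
    Tendsto (fun m : ℕ => ((n₀ + N * m : ℕ) : ℤ) + y) atTop cofinite := by
  rw [← Nat.cofinite_eq_atTop]
  refine Function.Injective.tendsto_cofinite fun i j hij => ?_
  have : N * i = N * j := by
    have : ((n₀ + N * i : ℕ) : ℤ) = (n₀ + N * j : ℕ) := add_right_cancel hij
    exact_mod_cast add_left_cancel (Nat.cast_injective this)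
  exact Nat.eq_of_mul_eq_mul_left (Nat.pos_of_ne_zero (NeZero.ne N)) this

noncomputable instance : Algebra (TateField K) (ClassGerm K N n₀) :=
  RingHom.toAlgebra (S := ClassGerm K N n₀) (evalHom (tendsto_class_cofinite N n₀ 0))

theorem algebraMap_classGerm (f : TateRing K) :
    algebraMap (TateField K) (ClassGerm K N n₀) (algebraMap _ _ f) =
      ClassGerm.of N n₀ fun n => f n := by
  refine (evalHom_algebraMap (tendsto_class_cofinite N n₀ 0) f).trans ?_
  refine congrArg (fun g : ℕ → K => (g : Germ (atTop : Filter ℕ) K)) (funext fun m => ?_)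
  simp

theorem algebraMap_classGerm_invLinear (i : ℕ) :
    algebraMap (TateField K) (ClassGerm K N n₀) (invLinear K i) =
      ClassGerm.of N n₀ fun n => 1 / ((n + i : ℕ) : K) := by
  refine (evalHom_invLinear (tendsto_class_cofinite N n₀ 0) i).trans ?_
  refine congrArg (fun g : ℕ → K => (g : Germ (atTop : Filter ℕ) K)) (funext fun m => ?_)
  simp

theorem shift_algebraMap (q : TateField K) :
    ClassGerm.shift (algebraMap (TateField K) (ClassGerm K N n₀) q) =
      algebraMap _ _ (fieldShift (N : ℤ) q) := by
  have : (ClassGerm.shift.comp (algebraMap (TateField K) (ClassGerm K N n₀))) =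
      (algebraMap _ _).comp (fieldShift (N : ℤ)) := by
    refine IsLocalization.ringHom_ext (nonZeroDivisors (TateRing K)) ?_
    ext f
    simp only [RingHom.comp_apply, algebraMap_classGerm, ClassGerm.shift_of, fieldShift_algebraMap,
      TateRing.shift_apply, Nat.cast_add]
  exact congrArg (fun φ => φ q) this

/-- The elements of `TateField K` which are invariant by translation are constant. -/
theorem exists_const_of_fieldShift_eq (q : TateField K) (hq : fieldShift (N : ℤ) q = q) :
    ∃ c : K, q = algebraMap _ _ (TateRing.C c) := by
  have h := shift_algebraMap (N := N) (n₀ := 0) q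
  rw [hq] at h
  obtain ⟨f, hf⟩ := ClassGerm.exists_of (algebraMap (TateField K) (ClassGerm K N 0) q)
  rw [← hf, ClassGerm.shift_of, ClassGerm.of_eq_of, eventually_atTop] at h
  obtain ⟨m₀, hm₀⟩ := h
  refine ⟨f (0 + N * m₀), (algebraMap (TateField K) (ClassGerm K N 0)).injective ?_⟩
  rw [algebraMap_classGerm, ← hf, ClassGerm.of_eq_of, eventually_atTop]
  refine ⟨m₀, fun m hm => ?_⟩
  induction m, hm using Nat.le_induction with
  | base => rfl
  | succ m hm ih =>
    have := hm₀ m hm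
    rw [show 0 + N * m + N = 0 + N * (m + 1) by ring] at this
    rw [this, ih, TateRing.C_apply, TateRing.C_apply]

variable {M : Type*} [CommGroup M]

variable (N n₀) in
/-- The coefficient of the leading part of the difference of `ratioSum ι · ((s, ε) :: u)` over a
period: `∑_{i < N} ε ^ (n + i) / (n + i) ^ s`, where `n` is congruent to `n₀` modulo `N`. -/
noncomputable def periodCoeff (ι : M →* K) (x : ℕ+ × M) : TateField K :=
  ∑ i ∈ Finset.range N,
    algebraMap _ _ (TateRing.C (ι x.2 ^ (n₀ + i))) * invLinear K i ^ (x.1 : ℕ)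

variable (ι : M →* K)

variable (N n₀) in
/-- The germ of `n ↦ ratioSum ι n u`. -/
noncomputable def ratioGerm (u : List (ℕ+ × M)) : ClassGerm K N n₀ :=
  ClassGerm.of N n₀ fun n => ratioSum ι n u

variable (hN : ∀ z, ι z ^ N = 1)

include hN in
theorem of_ratioSum_succ (j : ℕ) (x : ℕ+ × M) (u : List (ℕ+ × M)) :
    ClassGerm.of N n₀ (fun n => ratioSum ι (n + (j + 1)) (x :: u)) =
      ClassGerm.of N n₀ (fun n => ratioSum ι (n + j) (x :: u)) +
      (algebraMap _ (TateField K) (TateRing.C (ι x.2 ^ (n₀ + j))) * invLinear K j ^ (x.1 : ℕ)) •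
        ClassGerm.of N n₀ fun n => ratioSum ι (n + j) u := by
  rw [Algebra.smul_def, map_mul, map_pow (algebraMap (TateField K) _), algebraMap_classGerm,
    algebraMap_classGerm_invLinear, ← map_pow (ClassGerm.of N n₀), ← map_mul, ← map_mul, ← map_add,
    ClassGerm.of_eq_of]
  refine .of_forall fun m => ?_
  have h : ι x.2 ^ (n₀ + N * m + j) = ι x.2 ^ (n₀ + j) := by
    rw [show n₀ + N * m + j = n₀ + j + N * m by ring, pow_add, pow_mul, hN, one_pow, mul_one]
  rw [← add_assoc, ratioSum_succ, h]
  simp [div_eq_mul_inv]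

include hN in
theorem of_ratioSum_sub_mem (j : ℕ) (u : List (ℕ+ × M)) :
    ClassGerm.of N n₀ (fun n => ratioSum ι (n + j) u) - ratioGerm N n₀ ι u ∈
      Submodule.span (TateField K) (ratioGerm N n₀ ι '' {w | w.length < u.length}) := by
  induction j generalizing u with
  | zero => simp [ratioGerm]
  | succ j ih =>
    cases u with
    | nil => simp [ratioGerm, ratioSum]
    | cons x u =>
      rw [of_ratioSum_succ ι hN, add_sub_right_comm]
      refine add_mem (ih _) (Submodule.smul_mem _ _ ?_)
      rw [← sub_add_cancel (ClassGerm.of N n₀ _) (ratioGerm N n₀ ι u)]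
      refine add_mem (Submodule.span_mono (Set.image_mono fun w hw => ?_) (ih u))
        (Submodule.subset_span ⟨u, by simp, rfl⟩)
      have : w.length < u.length := by simpa using hw
      simp only [Set.mem_ofPred_eq, List.length_cons]
      omega

include hN in
theorem shift_ratioGerm_cons (x : ℕ+ × M) (u : List (ℕ+ × M)) :
    ClassGerm.shift (ratioGerm N n₀ ι (x :: u)) - ratioGerm N n₀ ι (x :: u) -
      periodCoeff N n₀ ι x • ratioGerm N n₀ ι u ∈
      Submodule.span (TateField K) (ratioGerm N n₀ ι '' {w | w.length < u.length}) := by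
  have h : ∀ j, ClassGerm.of N n₀ (fun n => ratioSum ι (n + j) (x :: u)) -
      ratioGerm N n₀ ι (x :: u) = ∑ i ∈ Finset.range j,
        (algebraMap _ (TateField K) (TateRing.C (ι x.2 ^ (n₀ + i))) * invLinear K i ^ (x.1 : ℕ)) •
          ClassGerm.of N n₀ fun n => ratioSum ι (n + i) u := by
    intro j
    induction j with
    | zero => simp [ratioGerm]
    | succ j ih => rw [Finset.sum_range_succ, ← ih, of_ratioSum_succ ι hN]; ring
  rw [ratioGerm, ClassGerm.shift_of, ← ratioGerm, h, periodCoeff, Finset.sum_smul,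
    ← Finset.sum_sub_distrib]
  refine sum_mem fun i _ => ?_
  rw [← smul_sub]
  exact Submodule.smul_mem _ _ (of_ratioSum_sub_mem ι hN i u)

variable [Fintype M] (hι : Function.Injective ι)

include hN hι in
/-- No nontrivial combination with constant coefficients of the `periodCoeff` is a difference. -/
theorem eq_zero_of_sum_periodCoeff {p : ℕ} (hp0 : p ≠ 0)
    (hp : Tendsto (fun j : ℕ => ((p ^ j : ℤ) : K)) atTop (𝓝 0))
    (l : ℕ+ × M →₀ TateField K) (q : TateField K) (hl : ∀ x, fieldShift (N : ℤ) (l x) = l x)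
    (h : l.sum (fun x a => a * periodCoeff N n₀ ι x) = fieldShift (N : ℤ) q - q) : l = 0 := by
  classical
  choose c hc using fun x => exists_const_of_fieldShift_eq (N := N) (l x) (hl x)
  obtain ⟨a, b, hb, rfl⟩ := IsFractionRing.div_surjective (A := TateRing K) q
  have hb0 : b ≠ 0 := nonZeroDivisors.ne_zero hb
  let P : ℕ → Polynomial K := fun i =>
    ∑ x ∈ l.support, Polynomial.monomial (x.1 : ℕ) (c x * ι x.2 ^ (n₀ + i))
  have hid : Tendsto (id : ℤ → ℤ) cofinite cofinite := tendsto_id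
  have hidN : Tendsto (fun n : ℤ => id n + (N : ℤ)) cofinite cofinite :=
    (add_left_injective (N : ℤ)).tendsto_cofinite
  have h1 : ∀ᶠ n : ℤ in cofinite, a (n + N) / b (n + N) - a n / b n =
      ∑ i ∈ Finset.range N, (P i).eval (1 / ((n + i : ℤ) : K)) := by
    have h2 := congrArg (evalHom hid) h
    rw [map_sub, evalHom_fieldShift hid hidN, evalHom_div _ _ _ hb0, evalHom_div _ _ _ hb0,
      Finsupp.sum, map_sum] at h2
    have h3 : ∀ x, evalHom hid (l x * periodCoeff N n₀ ι x) =
        Germ.coeRingHom cofinite (fun n : ℤ => ∑ i ∈ Finset.range N,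
          c x * ι x.2 ^ (n₀ + i) * (1 / ((n + i : ℤ) : K)) ^ (x.1 : ℕ)) := by
      intro x
      have h4 : (fun n : ℤ => ∑ i ∈ Finset.range N,
          c x * ι x.2 ^ (n₀ + i) * (1 / ((n + i : ℤ) : K)) ^ (x.1 : ℕ)) =
          ∑ i ∈ Finset.range N, (fun _ => c x) * ((fun _ => ι x.2 ^ (n₀ + i)) *
            (fun n : ℤ => 1 / ((n + i : ℤ) : K)) ^ (x.1 : ℕ)) := by
        ext n
        simp [mul_assoc]
      rw [h4, map_sum, hc, periodCoeff, Finset.mul_sum, map_sum]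
      refine Finset.sum_congr rfl fun i _ => ?_
      rw [map_mul, map_mul, map_mul, map_mul, map_pow (evalHom hid),
        map_pow (Germ.coeRingHom cofinite), evalHom_algebraMap, evalHom_algebraMap,
        evalHom_invLinear]
      rfl
    simp only [h3] at h2
    rw [← map_sum] at h2
    have h5 := Germ.coe_eq.1 h2.symm
    filter_upwards [h5] with n hn
    refine Eq.trans hn ?_
    rw [Finset.sum_apply, Finset.sum_comm]
    simp [P, Polynomial.eval_finsetSum, Polynomial.eval_monomial]
  have hP := eq_zero_of_difference hp0 hp N a b hb0 P (fun i _ => ?_) h1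
  · -- the coefficients of the `P i` are character sums, of period `N`
    have hcoeff : ∀ (s : ℕ+) (i : ℕ), ∑ ε : M, c (s, ε) * ι ε ^ n₀ * ι ε ^ i = 0 := by
      intro s i
      have h6 := congrArg (fun Q => Q.coeff (s : ℕ))
        (hP (i % N) (Nat.mod_lt _ (Nat.pos_of_ne_zero (NeZero.ne N))))
      simp only [P, Polynomial.finsetSum_coeff, Polynomial.coeff_monomial,
        Polynomial.coeff_zero] at h6
      rw [← h6, ← Finset.sum_filter]
      symm
      refine Finset.sum_of_injOn Prod.snd ?_ (by simp) ?_ ?_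
      · rintro ⟨s₁, ε₁⟩ hx₁ ⟨s₂, ε₂⟩ hx₂ (rfl : ε₁ = ε₂)
        simp only [Finset.coe_filter, Set.mem_ofPred_eq, PNat.coe_inj] at hx₁ hx₂
        rw [hx₁.2, hx₂.2]
      · intro ε _ hε
        have : l (s, ε) = 0 := by
          by_contra h0
          exact hε ⟨(s, ε), by simpa using h0, rfl⟩
        rw [hc, map_eq_zero_iff _ (IsFractionRing.injective (TateRing K) (TateField K)),
          map_eq_zero_iff _ TateRing.C_injective] at this
        rw [this, zero_mul, zero_mul]
      · rintro ⟨s₁, ε⟩ hx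
        simp only [Finset.mem_filter, PNat.coe_inj] at hx
        obtain rfl := hx.2
        have h7 : ι ε ^ i = ι ε ^ (i % N) := by
          conv_lhs => rw [← Nat.mod_add_div i N, pow_add, pow_mul, hN, one_pow, mul_one]
        rw [h7, pow_add, mul_assoc]
    ext x
    obtain ⟨s, ε⟩ := x
    have h8 := congrFun (eq_zero_of_forall_sum_mul_pow_eq_zero hι _ (hcoeff s)) ε
    have h9 : ι ε ≠ 0 := ((Group.isUnit ε).map ι).ne_zero
    have h10 : c (s, ε) = 0 := by simpa [h9] using h8
    rw [hc, h10, map_zero, map_zero, Finsupp.zero_apply]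
  · simp [P, Polynomial.coeff_monomial]

include hN hι in
/-- The multiple harmonic sums are linearly independent over the field of fractions of the ring of
convergent power series, on each class modulo `N`. -/
theorem linearIndependent_ratioGerm {p : ℕ} (hp0 : p ≠ 0)
    (hp : Tendsto (fun j : ℕ => ((p ^ j : ℤ) : K)) atTop (𝓝 0)) :
    LinearIndependent (TateField K) (ratioGerm N n₀ ι) := by
  refine linearIndependent_of_difference (fieldShift (N : ℤ)) ClassGerm.shift shift_algebraMap _
    (periodCoeff N n₀ ι) ?_ (shift_ratioGerm_cons ι hN)
    (eq_zero_of_sum_periodCoeff ι hN hι hp0 hp)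
  rw [ratioGerm, ← map_one (ClassGerm.of N n₀)]
  exact congrArg _ (funext fun n => by rw [ratioSum, Pi.one_apply])

end Independence

/-! ### Coefficients of the series `g⁻¹ e_1 g` -/

section Depth

variable {M : Type*}

theorem depth_append (u v : Word M) : depth (u ++ v) = depth u + depth v := List.countP_append

theorem depth_take_add_depth_drop (i : ℕ) (w : Word M) :
    depth (w.take i) + depth (w.drop i) = depth w := by
  rw [← depth_append, List.take_append_drop]

@[simp] theorem depth_nil : depth ([] : Word M) = 0 := rfl

@[simp] theorem depth_none_cons (w : Word M) : depth (none :: w) = depth w := by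
  simp [depth]

@[simp] theorem depth_some_cons (z : M) (w : Word M) : depth (some z :: w) = depth w + 1 := by
  simp [depth]

@[simp] theorem depth_replicate_none (b : ℕ) : depth (List.replicate b (none : Option M)) = 0 := by
  induction b with
  | zero => rfl
  | succ b ih => rw [List.replicate_succ, depth_none_cons, ih]

theorem eq_replicate_of_depth_eq_zero {w : Word M} (h : depth w = 0) :
    w = List.replicate w.length none := by
  refine List.eq_replicate_iff.2 ⟨rfl, fun a ha => ?_⟩
  have := List.countP_eq_zero.1 h a ha
  simpa using this

theorem depth_map (f : M → M) (w : Word M) : depth (w.map (Option.map f)) = depth w := by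
  induction w with
  | nil => rfl
  | cons a w ih => cases a <;> simp [ih]

end Depth

section Decay

variable {M K : Type*} [NormedField K]

/-- The coefficients of the words of depth at most `d` tend to `0` with the weight. -/
def DecaysUpTo (f : Series M K) (d : ℕ) : Prop :=
  ∀ ε : ℝ, 0 < ε → ∃ S : ℕ, ∀ w : Word M, S ≤ w.length → depth w ≤ d → ‖f w‖ < ε

theorem mul_apply (f h : Series M K) (w : Word M) :
    (f * h) w = ∑ i ∈ Finset.range (w.length + 1), f (w.take i) * h (w.drop i) := rfl

theorem one_apply (w : Word M) : (1 : Series M K) w = if w = [] then 1 else 0 := rfl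

theorem decaysUpTo_letter (a : Option M) (d : ℕ) : DecaysUpTo (letter a : Series M K) d := by
  intro ε hε
  refine ⟨2, fun w hw _ => ?_⟩
  rw [letter, if_neg, norm_zero]
  · exact hε
  · rintro rfl
    simp at hw

variable [Finite M]

theorem DecaysUpTo.exists_bound {f : Series M K} {d : ℕ} (hf : DecaysUpTo f d) :
    ∃ C, 0 < C ∧ ∀ w, depth w ≤ d → ‖f w‖ ≤ C := by
  obtain ⟨S, hS⟩ := hf 1 one_pos
  obtain ⟨C, hC⟩ := ((List.finite_length_lt (Option M) S).image fun w => ‖f w‖).bddAbove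
  refine ⟨max C 1, lt_max_of_lt_right one_pos, fun w hw => ?_⟩
  rcases lt_or_ge w.length S with h | h
  · exact (hC ⟨w, h, rfl⟩).trans (le_max_left _ _)
  · exact (hS w h hw).le.trans (le_max_right _ _)

theorem DecaysUpTo.norm_mul_lt {f h : Series M K} {d d' : ℕ} (hf : DecaysUpTo f d)
    (hh : DecaysUpTo h d') {ε : ℝ} (hε : 0 < ε) :
    ∃ S : ℕ, ∀ u v : Word M, S ≤ u.length + v.length → depth u ≤ d → depth v ≤ d' →
      ‖f u * h v‖ < ε := by
  obtain ⟨C, hC, hfC⟩ := hf.exists_bound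
  obtain ⟨D, hD, hhD⟩ := hh.exists_bound
  obtain ⟨S, hS⟩ := hf (ε / D) (by positivity)
  obtain ⟨T, hT⟩ := hh (ε / C) (by positivity)
  refine ⟨S + T, fun u v huv hu hv => ?_⟩
  rw [norm_mul]
  rcases le_or_gt S u.length with h1 | h1
  · calc ‖f u‖ * ‖h v‖ ≤ ‖f u‖ * D := by gcongr; exact hhD v hv
      _ < ε / D * D := by gcongr; exact hS u h1 hu
      _ = ε := div_mul_cancel₀ _ hD.ne'
  · calc ‖f u‖ * ‖h v‖ ≤ C * ‖h v‖ := by gcongr; exact hfC u hu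
      _ < C * (ε / C) := by gcongr; exact hT v (by omega) hv
      _ = ε := mul_div_cancel₀ _ hC.ne'

variable [IsUltrametricDist K]

theorem DecaysUpTo.mul {f h : Series M K} {d : ℕ} (hf : DecaysUpTo f d) (hh : DecaysUpTo h d) :
    DecaysUpTo (f * h) d := by
  intro ε hε
  obtain ⟨S, hS⟩ := hf.norm_mul_lt hh (half_pos hε)
  refine ⟨S, fun w hw hd => lt_of_le_of_lt ?_ (half_lt_self hε)⟩
  rw [mul_apply]
  refine IsUltrametricDist.norm_sum_le_of_forall_le_of_nonneg (half_pos hε).le fun i _ => ?_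
  have := depth_take_add_depth_drop i w
  refine (hS _ _ ?_ (by omega) (by omega)).le
  rw [← List.length_append, List.take_append_drop]
  exact hw

end Decay

section Group

variable {M K : Type*} [NormedField K]

theorem shuffle_singleton_replicate {X : Type*} (a : X) (c : ℕ) :
    shuffle [a] (List.replicate c a) = List.replicate (c + 1) (List.replicate (c + 1) a) := by
  induction c with
  | zero => simp [shuffle]
  | succ c ih =>
    rw [List.replicate_succ, shuffle, ih]
    simp [shuffle, List.replicate_succ]

/-- A solution of the shuffle equation without term in `e_0` has no term in the powers of `e_0`. -/
theorem ShuffleEquation.apply_replicate_eq_zero [CharZero K] {g : Series M K}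
    (hg : ShuffleEquation g) (h0 : g [none] = 0) (c : ℕ) :
    g (List.replicate (c + 1) none) = 0 := by
  have h := hg.2 [none] (List.replicate c none)
  rw [h0, zero_mul, shuffle_singleton_replicate] at h
  have h' : ((List.replicate (c + 1) (List.replicate (c + 1) none)).map fun w => g w).sum =
      ((c + 1 : ℕ) : K) * g (List.replicate (c + 1) none) := by
    rw [List.map_replicate, List.sum_replicate, nsmul_eq_mul]
  exact (mul_eq_zero.1 (h.trans h').symm).resolve_left (Nat.cast_ne_zero.2 c.succ_ne_zero)

/-- The recursive formula for the coefficients of an inverse. -/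
theorem inverse_apply {g g' : Series M K} (h1 : g [] = 1) (h : g' * g = 1) (w : Word M) :
    g' w = (if w = [] then 1 else 0) -
      ∑ i ∈ Finset.range w.length, g' (w.take i) * g (w.drop i) := by
  have := congrFun h w
  rw [mul_apply, one_apply, Finset.sum_range_succ, List.take_length, List.drop_length, h1,
    mul_one] at this
  rw [← this]
  ring

/-- The properties of the series `g⁻¹ e_1 g` on which the harmonic Ihara action depends: the part
of depth `1` is `e_1`, and the coefficients decay in each depth. -/
structure IsAdjointSeries [One M] (G : Series M K) : Prop where
  depth_zero : ∀ w, depth w = 0 → G w = 0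
  depth_one : ∀ w, depth w = 1 → w ≠ [some 1] → G w = 0
  apply_one : G [some 1] = 1
  decays : ∀ d, DecaysUpTo G d

variable [CommGroup M] [Finite M] [IsUltrametricDist K] [CharZero K]

theorem isAdjointSeries_of_mem {G : Series M K} (hG : G ∈ AdPiTildeSigma M K) :
    IsAdjointSeries G := by
  obtain ⟨g, ⟨hsh, h0, -, hdec⟩, g', hg', -, rfl⟩ := hG
  have hg0 : ∀ w : Word M, depth w = 0 → w ≠ [] → g w = 0 := fun w hw hne => by
    obtain ⟨c, hc⟩ := Nat.exists_eq_succ_of_ne_zero (List.length_pos_iff.2 hne).ne'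
    rw [eq_replicate_of_depth_eq_zero hw, hc]
    exact hsh.apply_replicate_eq_zero h0 c
  have hg'0 : ∀ w : Word M, depth w = 0 → w ≠ [] → g' w = 0 := fun w hw hne => by
    rw [inverse_apply hsh.1 hg' w, if_neg hne, Finset.sum_eq_zero, sub_zero]
    intro i hi
    rw [hg0 (w.drop i), mul_zero]
    · have := depth_take_add_depth_drop i w
      omega
    · simpa using hi
  have hg'1 : g' [] = 1 := by
    rw [inverse_apply hsh.1 hg' []]
    simp
  have hgdec : ∀ d, DecaysUpTo g d := by
    intro d
    induction d with
    | zero =>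
      intro ε hε
      refine ⟨1, fun w hw hd => ?_⟩
      rw [hg0 w (Nat.le_zero.1 hd) (List.length_pos_iff.1 hw), norm_zero]
      exact hε
    | succ d ih =>
      intro ε hε
      obtain ⟨S, hS⟩ := ih ε hε
      obtain ⟨T, hT⟩ := hdec (d + 1) (by omega) ε hε
      refine ⟨max S T, fun w hw hd => ?_⟩
      rcases Nat.le_succ_iff.1 hd with h | h
      · exact hS w (le_trans (le_max_left _ _) hw) h
      · exact hT w (le_trans (le_max_right _ _) hw) h
  have hg'dec : ∀ d, DecaysUpTo g' d := by
    intro d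
    induction d with
    | zero =>
      intro ε hε
      refine ⟨1, fun w hw hd => ?_⟩
      rw [hg'0 w (Nat.le_zero.1 hd) (List.length_pos_iff.1 hw), norm_zero]
      exact hε
    | succ d ih =>
      intro ε hε
      obtain ⟨S, hS⟩ := ih.norm_mul_lt (hgdec (d + 1)) (half_pos hε)
      refine ⟨S + 1, fun w hw hd => lt_of_le_of_lt ?_ (half_lt_self hε)⟩
      have hne : w ≠ [] := by rintro rfl; simp at hw
      rw [inverse_apply hsh.1 hg' w, if_neg hne, zero_sub, norm_neg]
      refine IsUltrametricDist.norm_sum_le_of_forall_le_of_nonneg (half_pos hε).le fun i hi => ?_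
      have hdep := depth_take_add_depth_drop i w
      -- the second factor vanishes in depth `0`, so the first one has smaller depth
      by_cases hd0 : depth (w.drop i) = 0
      · rw [hg0 _ hd0 (by simpa using hi), mul_zero, norm_zero]
        exact (half_pos hε).le
      · refine (hS _ _ ?_ (by omega) (by omega)).le
        rw [← List.length_append, List.take_append_drop]
        omega
  have hletter : ∀ w : Word M, w ≠ [some 1] → (letter (some 1) : Series M K) w = 0 :=
    fun w hw => if_neg hw
  have hh0 : ∀ w : Word M, depth w = 0 → (g' * letter (some 1) : Series M K) w = 0 := fun w hw => by
    rw [mul_apply]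
    refine Finset.sum_eq_zero fun i _ => ?_
    rw [hletter, mul_zero]
    intro h
    have := depth_take_add_depth_drop i w
    rw [h] at this
    simp at this
    omega
  have hG1 : ∀ w : Word M, depth w = 1 →
      (g' * letter (some 1) * g : Series M K) w = (g' * letter (some 1) : Series M K) w :=
      fun w hw => by
    rw [mul_apply, Finset.sum_range_succ, List.take_length, List.drop_length, hsh.1, mul_one,
      Finset.sum_eq_zero, zero_add]
    intro i hi
    have := depth_take_add_depth_drop i w
    by_cases hd0 : depth (w.take i) = 0
    · rw [hh0 _ hd0, zero_mul]
    · rw [hg0 _ (by omega) (by simpa using hi), mul_zero]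
  refine ⟨fun w hw => ?_, fun w hw hne => ?_, ?_, fun d =>
    ((hg'dec d).mul (decaysUpTo_letter _ d)).mul (hgdec d)⟩
  · rw [mul_apply]
    refine Finset.sum_eq_zero fun i _ => ?_
    have := depth_take_add_depth_drop i w
    rw [hh0 _ (by omega), zero_mul]
  · rw [hG1 w hw, mul_apply]
    refine Finset.sum_eq_zero fun i _ => ?_
    by_cases h : w.drop i = [some 1]
    · have hdep := depth_take_add_depth_drop i w
      rw [h] at hdep
      have htake : depth (w.take i) = 0 := by simp at hdep; omega
      rw [hg'0 _ htake, zero_mul]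
      intro hnil
      rw [← List.take_append_drop i w, hnil, h] at hne
      exact hne rfl
    · rw [hletter _ h, mul_zero]
  · rw [hG1 _ (by simp), mul_apply]
    simp [Finset.sum_range_succ, letter, hg'1]

end Group

/-! ### The harmonic Ihara action as a linear substitution -/

section Substitution

theorem depth_singleton_add {M : Type*} (a : Option M) (W : Word M) :
    depth [a] + depth W = depth (a :: W) := by
  cases a <;> simp [add_comm]

variable {M K : Type*} [CommGroup M] [NormedField K]

/-- The series substituted for the letters in the adjoint Ihara product. -/
noncomputable def adLetter (G : Series M K) : Option M → Series M K
  | none => letter none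
  | some z => rotate z G

/-- The coefficient of `v` in the series obtained by substitution in the word `W`. -/
noncomputable def adWord (G : Series M K) (W v : Word M) : K :=
  ((W.map (adLetter G)).prod : Series M K) v

theorem adWord_nil (G : Series M K) (v : Word M) : adWord G [] v = if v = [] then 1 else 0 := rfl

theorem adWord_cons (G : Series M K) (a : Option M) (W v : Word M) :
    adWord G (a :: W) v =
      ∑ i ∈ Finset.range (v.length + 1), adLetter G a (v.take i) * adWord G W (v.drop i) := rfl

theorem adWord_none_cons_none_cons (G : Series M K) (W v : Word M) :
    adWord G (none :: W) (none :: v) = adWord G W v := by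
  rw [adWord_cons, Finset.sum_eq_single 1]
  · simp [adLetter, letter]
  · intro i hi hi1
    rw [adLetter, letter, if_neg, zero_mul]
    intro h
    have := congrArg List.length h
    simp only [List.length_take, List.length_cons, List.length_nil] at this
    simp only [List.length_cons, Finset.mem_range] at hi
    omega
  · simp

theorem adWord_none_cons_eq_zero (G : Series M K) (W v : Word M) (hv : ∀ v', v ≠ none :: v') :
    adWord G (none :: W) v = 0 := by
  rw [adWord_cons]
  refine Finset.sum_eq_zero fun i _ => ?_
  rw [adLetter, letter, if_neg, zero_mul]
  intro h
  refine hv (v.drop i) ?_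
  conv_lhs => rw [← List.take_append_drop i v, h]
  rfl

theorem adWord_replicate_append (G : Series M K) (a l : ℕ) (W w : Word M)
    (hw : ∀ w', w ≠ none :: w') :
    adWord G (List.replicate a none ++ W) (List.replicate l none ++ w) =
      if a ≤ l then adWord G W (List.replicate (l - a) none ++ w) else 0 := by
  induction a generalizing l with
  | zero => simp
  | succ a ih =>
    cases l with
    | zero =>
      rw [if_neg (by omega)]
      exact adWord_none_cons_eq_zero G _ _ hw
    | succ l =>
      rw [List.replicate_succ, List.replicate_succ, List.cons_append, List.cons_append,
        adWord_none_cons_none_cons, ih]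
      simp

variable {G : Series M K} (hG : IsAdjointSeries G)

include hG

theorem adLetter_eq_zero_of_depth_lt {a : Option M} {u : Word M} (h : depth u < depth [a]) :
    adLetter G a u = 0 := by
  cases a with
  | none => simp at h
  | some z => exact hG.depth_zero _ (by rw [depth_map]; simpa using h)

theorem adLetter_nil (a : Option M) : adLetter G a [] = 0 := by
  cases a with
  | none => simp [adLetter, letter]
  | some z => exact adLetter_eq_zero_of_depth_lt hG (by simp)

open Classical in
theorem adLetter_of_depth_eq {a : Option M} {u : Word M} (h : depth u = depth [a]) :
    adLetter G a u = if u = [a] then 1 else 0 := by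
  cases a with
  | none => rfl
  | some z =>
    change G (u.map (Option.map (z⁻¹ * ·))) = _
    split_ifs with hu
    · rw [hu]
      simpa using hG.apply_one
    · refine hG.depth_one _ (by rw [depth_map]; simpa using h) fun h' => hu ?_
      obtain ⟨b, rfl, hb⟩ := List.map_eq_singleton_iff.1 h'
      cases b with
      | none => simp at hb
      | some y =>
        have : z⁻¹ * y = 1 := by simpa using hb
        rw [inv_mul_eq_one.1 this]

theorem adLetter_tauAd (n : ℕ) (a : Option M) (u : Word M) :
    adLetter (tauAd n G) a u * n = (n : K) ^ u.length * adLetter G a u := by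
  cases a with
  | none =>
    by_cases hu : u = [none]
    · simp [hu, adLetter, letter]
    · have : ∀ F : Series M K, adLetter F none u = 0 := fun F => if_neg hu
      rw [this, this, zero_mul, mul_zero]
  | some z =>
    change (n : K) ^ ((u.map (Option.map (z⁻¹ * ·))).length - 1) * adLetter G (some z) u * n = _
    cases u with
    | nil => rw [adLetter_nil hG]; simp
    | cons b u =>
      rw [List.length_map, List.length_cons, Nat.add_sub_cancel, pow_succ]
      ring

theorem adWord_tauAd (n : ℕ) (W v : Word M) :
    adWord (tauAd n G) W v * (n : K) ^ W.length = (n : K) ^ v.length * adWord G W v := by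
  induction W generalizing v with
  | nil =>
    rw [adWord_nil, adWord_nil]
    split_ifs with h
    · simp [h]
    · simp
  | cons a W ih =>
    rw [adWord_cons, adWord_cons, Finset.sum_mul, Finset.mul_sum]
    refine Finset.sum_congr rfl fun i _ => ?_
    calc _ = (adLetter (tauAd n G) a (v.take i) * n) *
          (adWord (tauAd n G) W (v.drop i) * (n : K) ^ W.length) := by
          rw [List.length_cons, pow_succ]; ring
      _ = (n : K) ^ ((v.take i).length + (v.drop i).length) *
          (adLetter G a (v.take i) * adWord G W (v.drop i)) := by
          rw [adLetter_tauAd hG, ih, pow_add]; ring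
      _ = _ := by rw [← List.length_append, List.take_append_drop]

theorem adWord_eq_zero_of_length_lt {W v : Word M} (h : v.length < W.length) :
    adWord G W v = 0 := by
  induction W generalizing v with
  | nil => simp at h
  | cons a W ih =>
    rw [adWord_cons]
    refine Finset.sum_eq_zero fun i _ => ?_
    by_cases hi : v.take i = []
    · rw [hi, adLetter_nil hG, zero_mul]
    · rw [ih, mul_zero]
      have h1 := List.length_pos_iff.2 hi
      have h2 : (v.take i).length + (v.drop i).length = v.length := by
        rw [← List.length_append, List.take_append_drop]
      rw [List.length_cons] at h
      omega

theorem adWord_eq_zero_of_depth_lt {W v : Word M} (h : depth v < depth W) :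
    adWord G W v = 0 := by
  induction W generalizing v with
  | nil => simp at h
  | cons a W ih =>
    rw [adWord_cons]
    refine Finset.sum_eq_zero fun i _ => ?_
    have h1 := depth_take_add_depth_drop i v
    have h2 := depth_singleton_add a W
    by_cases hi : depth (v.take i) < depth [a]
    · rw [adLetter_eq_zero_of_depth_lt hG hi, zero_mul]
    · rw [ih (by omega), mul_zero]

open Classical in
/-- Substitution is the identity on the part of maximal depth. -/
theorem adWord_of_depth_eq {W v : Word M} (h : depth v = depth W) :
    adWord G W v = if v = W then 1 else 0 := by
  induction W generalizing v with
  | nil => rfl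
  | cons a W ih =>
    have key : ∀ i, adLetter G a (v.take i) * adWord G W (v.drop i) =
        (if v.take i = [a] then 1 else 0) * if v.drop i = W then 1 else 0 := by
      intro i
      have h1 := depth_take_add_depth_drop i v
      have h2 := depth_singleton_add a W
      rcases lt_trichotomy (depth (v.take i)) (depth [a]) with hi | hi | hi
      · rw [adLetter_eq_zero_of_depth_lt hG hi, if_neg, zero_mul, zero_mul]
        intro h'
        rw [h'] at hi
        exact lt_irrefl _ hi
      · rw [adLetter_of_depth_eq hG hi, ih (by omega)]
      · rw [adWord_eq_zero_of_depth_lt hG (by omega), if_neg, zero_mul, mul_zero]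
        intro h'
        rw [h'] at hi
        exact lt_irrefl _ hi
    rw [adWord_cons, Finset.sum_congr rfl fun i _ => key i]
    split_ifs with hv
    · rw [Finset.sum_eq_single 1]
      · simp [hv]
      · intro i hi hi1
        rw [if_neg, zero_mul]
        intro h'
        have := congrArg List.length h'
        simp only [List.length_take, List.length_singleton] at this
        simp only [hv, List.length_cons, Finset.mem_range] at hi this
        omega
      · simp [hv]
    · refine Finset.sum_eq_zero fun i _ => ?_
      by_cases h1 : v.take i = [a]
      · rw [if_neg (c := v.drop i = W), mul_zero]
        intro h2
        refine hv ?_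
        rw [← List.take_append_drop i v, h1, h2]
        rfl
      · rw [if_neg h1, zero_mul]

theorem adWord_some_cons_replicate_append (y : M) (W w : Word M) (b : ℕ) :
    adWord G (some y :: W) (List.replicate b none ++ w) =
      ∑ j ∈ Finset.range (w.length + 1),
        rotate y G (List.replicate b none ++ w.take j) * adWord G W (w.drop j) := by
  rw [adWord_cons, List.length_append, List.length_replicate, add_assoc, Finset.sum_range_add,
    Finset.sum_eq_zero, zero_add]
  · refine Finset.sum_congr rfl fun j _ => ?_
    have h1 : (List.replicate b none ++ w).take (b + j) = List.replicate b none ++ w.take j := by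
      rw [List.take_append]
      simp
    have h2 : (List.replicate b none ++ w).drop (b + j) = w.drop j := by
      rw [List.drop_append]
      simp
    rw [h1, h2]
    rfl
  · intro i hi
    rw [adLetter_eq_zero_of_depth_lt hG, zero_mul]
    rw [List.take_append_of_le_length (by simpa using (Finset.mem_range.1 hi).le),
      List.take_replicate]
    simp

/-- In a harmonic word, the factor substituted for the first letter absorbs all the initial
letters `e_0`, so that the length of the words which contribute is bounded. -/
theorem adWord_toWord_eq_zero {w' : HarWord M} {w : Word M} (h : w.length < w'.toWord.length)
    (b : ℕ) : adWord G w'.toWord (List.replicate b none ++ w) = 0 := by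
  rw [HarWord.toWord, adWord_some_cons_replicate_append hG]
  rw [HarWord.toWord, List.length_cons] at h
  refine Finset.sum_eq_zero fun j _ => ?_
  cases j with
  | zero =>
    have : rotate w'.head G (List.replicate b none ++ w.take 0) = 0 :=
      hG.depth_zero _ (by rw [depth_map]; simp)
    rw [this, zero_mul]
  | succ j =>
    by_cases hw : w = []
    · have : rotate w'.head G (List.replicate b none ++ w.take (j + 1)) = 0 :=
        hG.depth_zero _ (by rw [depth_map, hw]; simp)
      rw [this, zero_mul]
    · rw [adWord_eq_zero_of_length_lt hG, mul_zero]
      have := List.length_pos_iff.2 hw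
      rw [List.length_drop]
      omega

theorem tendsto_adWord_toWord (w' : HarWord M) (w : Word M) :
    Tendsto (fun b => adWord G w'.toWord (List.replicate b none ++ w)) atTop (𝓝 0) := by
  simp only [HarWord.toWord, adWord_some_cons_replicate_append hG]
  rw [← Finset.sum_const_zero (ι := ℕ) (s := Finset.range (w.length + 1))]
  refine tendsto_finsetSum _ fun j _ => ?_
  rw [← zero_mul (adWord G _ (w.drop j))]
  refine Tendsto.mul_const _ ?_
  rw [Metric.tendsto_atTop]
  intro ε hε
  obtain ⟨S, hS⟩ := hG.decays (depth (w.take j)) ε hε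
  refine ⟨S, fun b hb => ?_⟩
  rw [dist_zero_right]
  refine hS _ ?_ ?_
  · simp
    omega
  · rw [depth_map, depth_append, depth_replicate_none, zero_add]

end Substitution

section HarmonicWords

variable {M : Type*}

theorem HarWord.toWord_ne_none_cons (w : HarWord M) (v : Word M) : w.toWord ≠ none :: v := by
  simp [HarWord.toWord]

theorem HarWord.toWord_injective : Function.Injective (HarWord.toWord (M := M)) := by
  rintro ⟨z, t⟩ ⟨z', t'⟩ h
  simp only [HarWord.toWord, List.cons.injEq, Option.some.injEq] at h
  have := congrArg (blocks 0) h.2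
  rw [blocks_flatMap, blocks_flatMap, Option.some.injEq] at this
  rw [h.1, this]

theorem replicate_append_of_blocks {k : ℕ} {w : Word M} {t : List (ℕ+ × M)}
    (h : blocks k w = some t) : List.replicate k none ++ w =
      t.flatMap fun x => List.replicate ((x.1 : ℕ) - 1) none ++ [some x.2] := by
  induction w generalizing k t with
  | nil =>
    cases k with
    | zero =>
      have : t = [] := by simpa [blocks, eq_comm] using h
      simp [this]
    | succ k => simp [blocks] at h
  | cons a w ih =>
    cases a with
    | none =>
      have h' : blocks (k + 1) w = some t := by cases k <;> simpa [blocks] using h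
      rw [← ih h', List.replicate_succ', List.append_assoc]
      rfl
    | some z =>
      have h' : ((blocks 0 w).map fun t => (k.succPNat, z) :: t) = some t := by
        cases k <;> simpa [blocks] using h
      obtain ⟨t', ht', rfl⟩ := Option.map_eq_some_iff.1 h'
      rw [List.flatMap_cons, ← ih ht']
      simp

theorem exists_of_toSeries_ne_zero {A : Type*} [Zero A] {h : HarWord M → A} {W : Word M}
    (hW : toSeries h W ≠ 0) :
    ∃ (a : ℕ) (w : HarWord M), W = List.replicate a none ++ w.toWord := by
  induction W with
  | nil => exact absurd rfl hW
  | cons c W ih =>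
    cases c with
    | none =>
      obtain ⟨a, w, rfl⟩ := ih hW
      exact ⟨a + 1, w, by rw [List.replicate_succ, List.cons_append]⟩
    | some z =>
      rw [toSeries] at hW
      cases hb : blocks 0 W with
      | none => simp [hb] at hW
      | some t =>
        refine ⟨0, ⟨z, t⟩, ?_⟩
        rw [HarWord.toWord, ← replicate_append_of_blocks hb]
        rfl

theorem replicate_append_toWord_inj {a a' : ℕ} {w w' : HarWord M}
    (h : List.replicate a none ++ w.toWord = List.replicate a' none ++ w'.toWord) :
    a = a' ∧ w = w' := by
  induction a generalizing a' with
  | zero =>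
    cases a' with
    | zero => exact ⟨rfl, HarWord.toWord_injective (by simpa using h)⟩
    | succ a' => exact absurd h (w.toWord_ne_none_cons _)
  | succ a ih =>
    cases a' with
    | zero => exact absurd h.symm (w'.toWord_ne_none_cons _)
    | succ a' =>
      simp only [List.replicate_succ, List.cons_append, List.cons.injEq, true_and] at h
      exact ⟨congrArg Nat.succ (ih h).1, (ih h).2⟩

theorem HarWord.finite_length_le [Finite M] (n : ℕ) :
    {w : HarWord M | w.toWord.length ≤ n}.Finite :=
  (List.finite_length_le (Option M) n).preimage HarWord.toWord_injective.injOn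

/-- The harmonic words of weight at most `n`. -/
noncomputable def harWordsUpTo (M : Type*) [Finite M] (n : ℕ) : Finset (HarWord M) :=
  (HarWord.finite_length_le n).toFinset

theorem mem_harWordsUpTo [Finite M] {n : ℕ} {w : HarWord M} :
    w ∈ harWordsUpTo M n ↔ w.toWord.length ≤ n := by
  simp [harWordsUpTo]

end HarmonicWords

section Transition

variable {M K : Type*} [CommGroup M] [NormedField K]
variable [IsUltrametricDist K] [CompleteSpace K]

/-- The coefficient of `h_n(w')` in `(G ∘_har h)_n(w)`, as a function of `n`. -/
noncomputable def transition {G : Series M K} (hG : IsAdjointSeries G) (w w' : HarWord M) :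
    TateRing K :=
  TateRing.X ^ (w.toWord.length - w'.toWord.length) *
    (TateRing.exists_of_tendsto_zero (tendsto_adWord_toWord hG w' w.toWord)).choose

theorem transition_of_depth_lt {G : Series M K} (hG : IsAdjointSeries G) {w w' : HarWord M}
    (h : depth w.toWord < depth w'.toWord) : transition hG w w' = 0 := by
  have h2 := (TateRing.exists_of_tendsto_zero
    (tendsto_adWord_toWord hG w' w.toWord)).choose_spec
  refine TateRing.ext fun n => ?_
  rw [transition, TateRing.mul_apply, (h2 n).unique (a₂ := 0), mul_zero, TateRing.zero_apply]
  have h3 : ∀ b, adWord G w'.toWord (List.replicate b none ++ w.toWord) = 0 := fun b =>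
    adWord_eq_zero_of_depth_lt hG (by rwa [depth_append, depth_replicate_none, zero_add])
  simp [h3]

open Classical in
theorem transition_of_depth_eq {G : Series M K} (hG : IsAdjointSeries G) {w w' : HarWord M}
    (h : depth w'.toWord = depth w.toWord) :
    transition hG w w' = if w' = w then 1 else 0 := by
  have h2 := (TateRing.exists_of_tendsto_zero
    (tendsto_adWord_toWord hG w' w.toWord)).choose_spec
  set f := (TateRing.exists_of_tendsto_zero
    (tendsto_adWord_toWord hG w' w.toWord)).choose with hf
  have h3 : ∀ n, f n = if w' = w then 1 else 0 := by
    intro n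
    refine (h2 n).unique ?_
    have h4 : ∀ b, adWord G w'.toWord (List.replicate b none ++ w.toWord) =
        if b = 0 ∧ w' = w then 1 else 0 := by
      intro b
      rw [adWord_of_depth_eq hG (by rw [depth_append, depth_replicate_none, zero_add, h])]
      refine if_congr ⟨fun h5 => ?_, ?_⟩ rfl rfl
      · have := replicate_append_toWord_inj (a' := 0) (w' := w') (by simpa using h5)
        exact ⟨this.1, this.2.symm⟩
      · rintro ⟨rfl, rfl⟩
        rfl
    simp only [h4]
    convert! hasSum_single (f := fun b => (if b = 0 ∧ w' = w then 1 else 0 : K) * (n : K) ^ b) 0 ?_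
      using 1
    · simp
    · intro b hb
      simp [hb]
  refine TateRing.ext fun n => ?_
  rw [transition, TateRing.mul_apply, h3]
  split_ifs with hw
  · simp [hw]
  · simp

end Transition

section Action

variable {M K : Type*} [CommGroup M] [Fintype M] [NormedField K]

theorem adIhara_apply (G F : Series M K) (v : Word M) :
    adIhara G F v = ∑ W ∈ (List.finite_length_le (Option M) v.length).toFinset,
      F W * adWord G W v := by
  have hφ : adIhara G F = subst (adLetter G) F := by
    unfold adIhara
    congr 1
  have h : adIhara G F v = ∑ k ∈ Finset.range (v.length + 1), ∑ w : Fin k → Option M,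
      F (List.ofFn w) * adWord G (List.ofFn w) v := by
    rw [hφ]
    rfl
  rw [h, Finset.sum_sigma']
  refine Finset.sum_bij (fun x _ => List.ofFn x.2) ?_ ?_ ?_ ?_
  · rintro ⟨k, w⟩ hx
    simpa [Nat.lt_succ_iff] using hx
  · rintro ⟨k, w⟩ _ ⟨k', w'⟩ _ h
    exact List.ofFn_inj'.1 h
  · intro W hW
    have : W.length ≤ v.length := by simpa using hW
    exact ⟨⟨W.length, W.get⟩, by simpa [Nat.lt_succ_iff] using this, by simp⟩
  · rintro ⟨k, w⟩ _
    rfl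

theorem adIhara_toSeries {G : Series M K} (hG : IsAdjointSeries G) {n : ℕ} (hn : (n : K) ≠ 0)
    (h : HarWord M → K) (w : HarWord M) (l : ℕ) :
    adIhara (tauAd n G) (toSeries h) (List.replicate l none ++ w.toWord) =
      ∑ b ∈ Finset.range (l + 1), ∑ w' ∈ harWordsUpTo M w.toWord.length,
        h w' * ((n : K) ^ (w.toWord.length - w'.toWord.length) *
          (adWord G w'.toWord (List.replicate b none ++ w.toWord) * (n : K) ^ b)) := by
  have hτ : ∀ W v : Word M, adWord (tauAd n G) W v =
      (n : K) ^ v.length * adWord G W v / (n : K) ^ W.length := fun W v => by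
    rw [eq_div_iff (pow_ne_zero _ hn), adWord_tauAd hG]
  rw [adIhara_apply, ← Finset.sum_range_reflect, ← Finset.sum_product']
  symm
  refine Finset.sum_of_injOn (fun x => List.replicate x.1 none ++ x.2.toWord) ?_ ?_ ?_ ?_
  · rintro ⟨a, w₁⟩ _ ⟨a', w₂⟩ _ h
    obtain ⟨rfl, rfl⟩ := replicate_append_toWord_inj h
    rfl
  · rintro ⟨a, w'⟩ hx
    simp only [Finset.coe_product, Set.mem_prod, Finset.mem_coe, Finset.mem_range,
      mem_harWordsUpTo] at hx
    simp
    omega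
  · intro W _ hW
    by_contra hne
    obtain ⟨a, w', rfl⟩ := exists_of_toSeries_ne_zero (left_ne_zero_of_mul hne)
    have h2 := right_ne_zero_of_mul hne
    rw [adWord_replicate_append _ _ _ _ _ w.toWord_ne_none_cons] at h2
    split_ifs at h2 with hal
    · rw [hτ] at h2
      refine hW ⟨(a, w'), ?_, rfl⟩
      simp only [Finset.coe_product, Set.mem_prod, Finset.mem_coe, Finset.mem_range,
        mem_harWordsUpTo]
      refine ⟨by omega, ?_⟩
      by_contra hlt
      rw [adWord_toWord_eq_zero hG (not_le.1 hlt)] at h2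
      simp at h2
    · exact h2 rfl
  · rintro ⟨a, w'⟩ hx
    simp only [Finset.mem_product, Finset.mem_range, mem_harWordsUpTo] at hx
    rw [toSeries_apply, adWord_replicate_append _ _ _ _ _ w.toWord_ne_none_cons,
      if_pos (by omega), hτ]
    have h1 : l + 1 - 1 - a = l - a := by omega
    have h2 : (List.replicate (l - a) none ++ w.toWord).length =
        w.toWord.length - w'.toWord.length + (l - a) + w'.toWord.length := by
      simp
      omega
    rw [h1, h2, pow_add, pow_add]
    field_simp

variable [IsUltrametricDist K] [CompleteSpace K] [CharZero K]

/-- The harmonic Ihara action is a finite linear substitution, whose coefficients are convergent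
power series in `n`. -/
theorem harIhara_apply {G : Series M K} (hG : IsAdjointSeries G) (h : ℕ → HarWord M → K) {n : ℕ}
    (hn : n ≠ 0) (w : HarWord M) :
    harIhara G h n w =
      ∑ w' ∈ harWordsUpTo M w.toWord.length, transition hG w w' n * h n w' := by
  refine Tendsto.limUnder_eq ?_
  simp only [adIhara_toSeries hG (Nat.cast_ne_zero.2 hn)]
  have h1 : ∀ l : ℕ, ∑ b ∈ Finset.range (l + 1), ∑ w' ∈ harWordsUpTo M w.toWord.length,
        h n w' * ((n : K) ^ (w.toWord.length - w'.toWord.length) *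
          (adWord G w'.toWord (List.replicate b none ++ w.toWord) * (n : K) ^ b)) =
      ∑ w' ∈ harWordsUpTo M w.toWord.length,
        ((n : K) ^ (w.toWord.length - w'.toWord.length) * ∑ b ∈ Finset.range (l + 1),
          adWord G w'.toWord (List.replicate b none ++ w.toWord) * (n : K) ^ b) * h n w' := by
    intro l
    rw [Finset.sum_comm]
    simp only [Finset.mul_sum, Finset.sum_mul]
    exact Finset.sum_congr rfl fun w' _ => Finset.sum_congr rfl fun b _ => by ring
  simp only [h1]
  refine tendsto_finsetSum _ fun w' _ => Tendsto.mul_const _ ?_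
  have h2 := (TateRing.exists_of_tendsto_zero
    (tendsto_adWord_toWord hG w' w.toWord)).choose_spec n
  simp only [Int.cast_natCast] at h2
  rw [transition, TateRing.mul_apply, TateRing.pow_apply, TateRing.X_apply, Int.cast_natCast]
  exact (h2.tendsto_sum_nat.comp (tendsto_add_atTop_nat 1)).const_mul _

end Action

/-! ### Harmonic words in terms of ratios, and the quasi-shuffle product -/

section Ratios

variable {M : Type*}

/-- The weight `s_d + ⋯ + s_1` of a word in the letters `(s_i, ε_i)`. -/
def ratioWeight (u : List (ℕ+ × M)) : ℕ := (u.map fun x => (x.1 : ℕ)).sum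

theorem HarWord.length_toWord (w : HarWord M) : w.toWord.length = ratioWeight w.tail + 1 := by
  obtain ⟨z, t⟩ := w
  simp only [HarWord.toWord, ratioWeight, List.length_cons, add_left_inj]
  induction t with
  | nil => rfl
  | cons x t ih =>
    rw [List.flatMap_cons, List.length_append, ih, List.map_cons, List.sum_cons]
    have := x.1.pos
    simp
    omega

theorem HarWord.depth_toWord (w : HarWord M) : depth w.toWord = w.tail.length + 1 := by
  obtain ⟨z, t⟩ := w
  simp only [HarWord.toWord, depth_some_cons, add_left_inj]
  induction t with
  | nil => rfl
  | cons x t ih => simp [depth_append, ih]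

variable [CommGroup M]

/-- From `z_{d+1}` and the list of the `(s_i, z_i)` to the list of the `(s_i, z_{i+1}/z_i)`. -/
def ratiosAux : M → List (ℕ+ × M) → List (ℕ+ × M)
  | _, [] => []
  | z, (s, z') :: t => (s, z / z') :: ratiosAux z' t

/-- The word of the `(s_i, z_{i+1}/z_i)` of a harmonic word. -/
def HarWord.ratios (w : HarWord M) : List (ℕ+ × M) := ratiosAux w.head w.tail

theorem HarWord.ofRatios_ratios (w : HarWord M) : ofRatios w.head w.ratios = w := by
  obtain ⟨z, t⟩ := w
  simp only [ofRatios, HarWord.ratios, HarWord.mk.injEq, true_and]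
  induction t generalizing z with
  | nil => rfl
  | cons x t ih => simp [ratiosAux, ofRatiosAux, ih]

theorem ratios_ofRatios (z : M) (u : List (ℕ+ × M)) : (ofRatios z u).ratios = u := by
  simp only [ofRatios, HarWord.ratios]
  induction u generalizing z with
  | nil => rfl
  | cons x t ih => simp [ratiosAux, ofRatiosAux, ih]

theorem ofRatiosAux_map_fst (z : M) (u : List (ℕ+ × M)) :
    (ofRatiosAux z u).map Prod.fst = u.map Prod.fst := by
  induction u generalizing z with
  | nil => rfl
  | cons x t ih => simp [ofRatiosAux, ih]

theorem ratioWeight_ofRatios_tail (z : M) (u : List (ℕ+ × M)) :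
    ratioWeight (ofRatios z u).tail = ratioWeight u := by
  have h : ∀ v : List (ℕ+ × M), ratioWeight v = ((v.map Prod.fst).map fun s : ℕ+ => (s : ℕ)).sum :=
    fun v => by rw [List.map_map]; rfl
  rw [h, h, ofRatios, ofRatiosAux_map_fst]

theorem length_ofRatios_tail (z : M) (u : List (ℕ+ × M)) :
    (ofRatios z u).tail.length = u.length := by
  simpa [ofRatios] using congrArg List.length (ofRatiosAux_map_fst z u)

theorem HarWord.length_ratios (w : HarWord M) : w.ratios.length = w.tail.length := by
  conv_rhs => rw [← w.ofRatios_ratios]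
  rw [length_ofRatios_tail]

theorem map_toWord_ofRatios (x z : M) (u : List (ℕ+ × M)) :
    (ofRatios z u).toWord.map (Option.map (x⁻¹ * ·)) = (ofRatios (z / x) u).toWord := by
  simp only [HarWord.toWord, ofRatios, List.map_cons, Option.map_some, List.cons.injEq,
    inv_mul_eq_div, true_and]
  induction u generalizing z with
  | nil => rfl
  | cons y t ih => simp [ofRatiosAux, ih, div_right_comm]

theorem ratioWeight_of_mem_stuffle {u v w : List (ℕ+ × M)} (hw : w ∈ stuffle u v) :
    ratioWeight w = ratioWeight u + ratioWeight v := by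
  induction u, v using stuffle.induct generalizing w with
  | case1 v =>
    rw [stuffle, List.mem_singleton] at hw
    simp [hw, ratioWeight]
  | case2 a u =>
    rw [stuffle, List.mem_singleton] at hw
    simp [hw, ratioWeight]
  | case3 a u b v ih1 ih2 ih3 =>
    rw [stuffle] at hw
    simp only [List.mem_append, List.mem_map] at hw
    rcases hw with (⟨w, hw, rfl⟩ | ⟨w, hw, rfl⟩) | ⟨w, hw, rfl⟩
    · have := ih1 hw
      simp only [ratioWeight, List.map_cons, List.sum_cons] at this ⊢
      omega
    · have := ih2 hw
      simp only [ratioWeight, List.map_cons, List.sum_cons] at this ⊢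
      omega
    · have := ih3 hw
      simp only [ratioWeight, List.map_cons, List.sum_cons, PNat.add_coe] at this ⊢
      omega

/-- The quasi-shuffle product of two formal combinations of words. -/
noncomputable def stuffleMul {L : Type*} [CommRing L] (α β : List (ℕ+ × M) →₀ L) :
    List (ℕ+ × M) →₀ L :=
  α.sum fun u a => β.sum fun v b => ((stuffle u v).map fun w => Finsupp.single w (a * b)).sum

theorem sum_stuffle_single_nil {L : Type*} [CommRing L] (u v : List (ℕ+ × M)) (c : L) :
    ((stuffle u v).map fun w => Finsupp.single w c).sum [] = if u = [] ∧ v = [] then c else 0 := by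
  have hcons : ∀ (f : List (ℕ+ × M) → List (ℕ+ × M)), (∀ w, f w ≠ []) →
      ∀ l : List (List (ℕ+ × M)),
      (((l.map f).map fun w => Finsupp.single w c).sum : List (ℕ+ × M) →₀ L) [] = 0 := by
    intro f hf l
    induction l with
    | nil => rfl
    | cons w l ih =>
      rw [List.map_cons, List.map_cons, List.sum_cons, Finsupp.add_apply, ih,
        Finsupp.single_eq_of_ne (hf w).symm, add_zero]
  cases u with
  | nil =>
    cases v with
    | nil => simp [stuffle]
    | cons b v => simp [stuffle]
  | cons a u =>
    cases v with
    | nil => simp [stuffle]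
    | cons b v =>
      rw [stuffle, List.map_append, List.map_append, List.sum_append, List.sum_append,
        Finsupp.add_apply, Finsupp.add_apply, hcons _ (by simp), hcons _ (by simp),
        hcons _ (by simp)]
      simp

/-- The empty word occurs in a quasi-shuffle product only as the product of empty words. -/
theorem stuffleMul_nil {L : Type*} [CommRing L] (α β : List (ℕ+ × M) →₀ L) :
    stuffleMul α β [] = α [] * β [] := by
  rw [stuffleMul, Finsupp.sum, Finsupp.finsetSum_apply]
  simp only [Finsupp.sum, Finsupp.finsetSum_apply, sum_stuffle_single_nil]
  rw [Finset.sum_eq_single []]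
  · rw [Finset.sum_eq_single []]
    · simp
    · intro v _ hv
      simp [hv]
    · intro h
      simp [Finsupp.notMem_support_iff.1 h]
  · intro u _ hu
    simp [hu]
  · intro h
    simp [Finsupp.notMem_support_iff.1 h]

theorem linearCombination_stuffleMul {L A : Type*} [CommRing L] [CommRing A] [Algebra L A]
    {F : List (ℕ+ × M) → A} (hF : ∀ u v, F u * F v = ((stuffle u v).map F).sum)
    (α β : List (ℕ+ × M) →₀ L) :
    Finsupp.linearCombination L F (stuffleMul α β) =
      Finsupp.linearCombination L F α * Finsupp.linearCombination L F β := by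
  have h : ∀ (c : L) (l : List (List (ℕ+ × M))),
      Finsupp.linearCombination L F ((l.map fun w => Finsupp.single w c).sum) =
        c • (l.map F).sum := by
    intro c l
    induction l with
    | nil => simp
    | cons w l ih => simp [ih]
  rw [stuffleMul, map_finsuppSum, Finsupp.linearCombination_apply, Finsupp.sum_mul]
  refine Finsupp.sum_congr fun u _ => ?_
  rw [map_finsuppSum, Finsupp.linearCombination_apply, Finsupp.mul_sum]
  refine Finsupp.sum_congr fun v _ => ?_
  rw [h, smul_mul_smul_comm, hF]

end Ratios

/-! ### Extraction of the adjoint quasi-shuffle relation -/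

section Coefficients

variable {M K : Type*} [CommGroup M] [NormedField K] [IsUltrametricDist K] [CompleteSpace K]
  {G : Series M K}

/-- The coefficient of the term without nested sum, up to a power of `n`:
`∑_b n ^ b G^{(x)}[e_0^b w]`. -/
noncomputable def headSeries (hG : IsAdjointSeries G) (w : HarWord M) (x : M) : TateRing K :=
  (TateRing.exists_of_tendsto_zero (tendsto_adWord_toWord hG ⟨x, []⟩ w.toWord)).choose

theorem transition_nil (hG : IsAdjointSeries G) (w : HarWord M) (x : M) :
    transition hG w ⟨x, []⟩ = TateRing.X ^ ratioWeight w.tail * headSeries hG w x := by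
  rw [transition, headSeries, HarWord.length_toWord, HarWord.length_toWord]
  simp [ratioWeight]

theorem hasExpansion_headSeries (hG : IsAdjointSeries G) (z x : M) (u : List (ℕ+ × M)) :
    HasExpansion (fun b => G (List.replicate b none ++ (ofRatios (z / x) u).toWord))
      (headSeries hG (ofRatios z u) x) := by
  have h := (TateRing.exists_of_tendsto_zero
    (tendsto_adWord_toWord hG ⟨x, []⟩ (ofRatios z u).toWord)).choose_spec
  have h1 : ∀ b, G (List.replicate b none ++ (ofRatios (z / x) u).toWord) =
      adWord G (HarWord.toWord ⟨x, []⟩) (List.replicate b none ++ (ofRatios z u).toWord) := by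
    intro b
    rw [← map_toWord_ofRatios]
    change _ = adWord G [some x] _
    rw [adWord_cons, Finset.sum_range_succ, List.take_length, List.drop_length,
      Finset.sum_eq_zero, zero_add, adWord_nil, if_pos rfl, mul_one]
    · change _ = G _
      rw [List.map_append, List.map_replicate]
      rfl
    · intro i hi
      rw [adWord_nil, if_neg, mul_zero]
      simpa using! hi
  simp only [h1]
  exact h

end Coefficients

section Germs

theorem eventually_class_ne_zero {N : ℕ} [NeZero N] {n₀ : ℕ} :
    ∀ᶠ m : ℕ in atTop, n₀ + N * m ≠ 0 := by
  filter_upwards [eventually_ge_atTop 1] with m hm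
  have := Nat.mul_pos (Nat.pos_of_ne_zero (NeZero.ne N)) hm
  omega

variable {M K : Type*} [CommGroup M] [NormedField K]

theorem har_eq (ι : M →* K) (n : ℕ) (w : HarWord M) :
    har ι n w = (1 / ι w.head) ^ n * ((n : K) ^ ratioWeight w.tail * ratioSum ι n w.ratios) := by
  have h : nestedSum ι n w.head w.tail = ratioSum ι n w.ratios := by
    conv_lhs => rw [← w.ofRatios_ratios]
    exact nestedSum_ofRatiosAux ι n w.head w.ratios
  rw [har, h, ratioWeight]
  ring

/-- The quasi-shuffle product with a harmonic word of depth `0` changes the head only. -/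
theorem eq_pow_mul_of_quasiShuffle (ι : M →* K) {f : ℕ → HarWord M → K} (hf : QuasiShuffle f)
    {n : ℕ} (h0 : ∀ z, f n ⟨z, []⟩ = (1 / ι z) ^ n) (w : HarWord M) :
    f n w = (1 / ι w.head) ^ n * f n (ofRatios 1 w.ratios) := by
  have h := hf n w.head 1 [] w.ratios
  rw [stuffle, mul_one] at h
  simp only [List.map_cons, List.map_nil, List.sum_cons, List.sum_nil, add_zero,
    HarWord.ofRatios_ratios] at h
  rw [← h, ← h0]
  rfl

theorem of_list_sum {N n₀ : ℕ} {X : Type*} (l : List X) (φ : X → ℕ → K) :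
    ClassGerm.of N n₀ (fun n => (l.map fun x => φ x n).sum) =
      (l.map fun x => ClassGerm.of N n₀ (φ x)).sum := by
  induction l with
  | nil => exact map_zero (ClassGerm.of N n₀)
  | cons x l ih =>
    rw [List.map_cons, List.sum_cons, ← ih, ← map_add]
    rfl

variable [IsUltrametricDist K] [CompleteSpace K] [CharZero K] {N : ℕ} [NeZero N] {n₀ : ℕ}

theorem of_mul_eq_smul (T : TateRing K) (φ : ℕ → K) :
    ClassGerm.of N n₀ (fun n => T n * φ n) =
      algebraMap (TateRing K) (TateField K) T • ClassGerm.of N n₀ φ := by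
  rw [Algebra.smul_def, algebraMap_classGerm, ← map_mul]
  rfl

theorem of_mul_pow_class (ι : M →* K) (hN : ∀ z, ι z ^ N = 1) (x : M) (φ : ℕ → K) :
    ClassGerm.of N n₀ (fun n => (1 / ι x) ^ n * φ n) =
      algebraMap (TateRing K) (TateField K) (TateRing.C ((1 / ι x) ^ n₀)) •
        ClassGerm.of N n₀ φ := by
  rw [← of_mul_eq_smul, ClassGerm.of_eq_of]
  refine .of_forall fun m => ?_
  rw [TateRing.C_apply, pow_add, pow_mul, div_pow _ _ N, hN, one_pow, div_one, one_pow, mul_one]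

theorem of_har (ι : M →* K) (hN : ∀ z, ι z ^ N = 1) (w : HarWord M) :
    ClassGerm.of N n₀ (fun n => har ι n w) =
      algebraMap (TateRing K) (TateField K)
        (TateRing.C ((1 / ι w.head) ^ n₀) * TateRing.X ^ ratioWeight w.tail) •
          ratioGerm N n₀ ι w.ratios := by
  simp only [har_eq ι]
  rw [of_mul_pow_class ι hN, map_mul, mul_smul, ratioGerm, ← of_mul_eq_smul (TateRing.X ^ _)]
  simp

end Germs

section Main

variable {M K : Type*} [CommGroup M] [Fintype M] [NormedField K] [IsUltrametricDist K]
  [CompleteSpace K] [CharZero K] {N : ℕ} [NeZero N] {n₀ : ℕ} {G : Series M K} (ι : M →* K)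

theorem of_harIhara (hG : IsAdjointSeries G) (h : ℕ → HarWord M → K) (w : HarWord M) :
    ClassGerm.of N n₀ (fun n => harIhara G h n w) =
      ∑ w' ∈ harWordsUpTo M w.toWord.length,
        algebraMap (TateRing K) (TateField K) (transition hG w w') •
          ClassGerm.of N n₀ fun n => h n w' := by
  simp only [← of_mul_eq_smul]
  rw [← map_sum, ClassGerm.of_eq_of]
  filter_upwards [eventually_class_ne_zero (N := N) (n₀ := n₀)] with m hm
  rw [harIhara_apply hG h hm, Finset.sum_apply]

variable (N n₀) in
/-- The germ of `n ↦ f_n([1; u])`. -/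
noncomputable def familyGerm (f : ℕ → HarWord M → K) (u : List (ℕ+ × M)) : ClassGerm K N n₀ :=
  ClassGerm.of N n₀ fun n => f n (ofRatios 1 u)

/-- In an element of the orbit of the multiple harmonic sums, the terms of maximal depth are the
multiple harmonic sums themselves, whence the linear independence. -/
theorem linearIndependent_familyGerm (hN : ∀ z, ι z ^ N = 1) (hι : Function.Injective ι)
    {p : ℕ} (hp0 : p ≠ 0) (hp : Tendsto (fun j : ℕ => ((p ^ j : ℤ) : K)) atTop (𝓝 0))
    (hG : IsAdjointSeries G) :
    LinearIndependent (TateField K) (familyGerm N n₀ (harIhara G (har ι))) := by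
  classical
  refine linearIndependent_of_triangular (linearIndependent_ratioGerm ι hN hι hp0 hp)
    (t := fun u => algebraMap (TateRing K) (TateField K) (TateRing.X ^ ratioWeight u))
    (fun u => ?_) fun u => ?_
  · rw [Ne, map_eq_zero_iff _ (IsFractionRing.injective (TateRing K) (TateField K))]
    exact pow_ne_zero _ TateRing.X_ne_zero
  · rw [familyGerm, of_harIhara hG, ← Finset.add_sum_erase _ _
      (mem_harWordsUpTo.2 (le_refl (ofRatios (1 : M) u).toWord.length)),
      transition_of_depth_eq hG rfl, if_pos rfl, map_one, one_smul, of_har ι hN, ratios_ofRatios,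
      ratioWeight_ofRatios_tail]
    have h1 : TateRing.C ((1 / ι (ofRatios (1 : M) u).head) ^ n₀) = 1 := by simp [ofRatios]
    rw [h1, one_mul, add_sub_cancel_left]
    refine sum_mem fun w hw => ?_
    rcases lt_trichotomy (depth w.toWord) (depth (ofRatios (1 : M) u).toWord) with h | h | h
    · rw [of_har ι hN]
      refine Submodule.smul_mem _ _ (Submodule.smul_mem _ _ (Submodule.subset_span ⟨_, ?_, rfl⟩))
      rw [HarWord.depth_toWord, HarWord.depth_toWord, length_ofRatios_tail] at h
      rw [Set.mem_ofPred_eq, HarWord.length_ratios]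
      omega
    · rw [transition_of_depth_eq hG h, if_neg (Finset.ne_of_mem_erase hw), map_zero, zero_smul]
      exact zero_mem _
    · rw [transition_of_depth_lt hG h, map_zero, zero_smul]
      exact zero_mem _

/-- The action does not change the families in depth `0`. -/
theorem harIhara_apply_nil (hG : IsAdjointSeries G) (h : ℕ → HarWord M → K) {n : ℕ} (hn : n ≠ 0)
    (z : M) : harIhara G h n ⟨z, []⟩ = h n ⟨z, []⟩ := by
  classical
  rw [harIhara_apply hG h hn, Finset.sum_eq_single ⟨z, []⟩]
  · rw [transition_of_depth_eq hG rfl, if_pos rfl, TateRing.one_apply, one_mul]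
  · intro w _ hw
    rcases Nat.eq_zero_or_pos w.tail.length with h0 | h0
    · rw [transition_of_depth_eq hG (by rw [HarWord.depth_toWord, HarWord.depth_toWord, h0]; rfl),
        if_neg hw, TateRing.zero_apply, zero_mul]
    · rw [transition_of_depth_lt hG (by rw [HarWord.depth_toWord, HarWord.depth_toWord]; simpa),
        TateRing.zero_apply, zero_mul]
  · exact fun h => absurd (mem_harWordsUpTo.2 le_rfl) h

variable (n₀) in
/-- The formal combination of words, with coefficients in `TateField K`, which represents
`n ↦ (G ∘_har f)_n(w)` on the class of `n₀`. -/
noncomputable def expansion (hG : IsAdjointSeries G) (w : HarWord M) :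
    List (ℕ+ × M) →₀ TateField K :=
  ∑ w' ∈ harWordsUpTo M w.toWord.length, Finsupp.single w'.ratios
    (algebraMap (TateRing K) (TateField K)
      (transition hG w w' * TateRing.C ((1 / ι w'.head) ^ n₀)))

theorem linearCombination_expansion (hN : ∀ z, ι z ^ N = 1) (hG : IsAdjointSeries G)
    {f : ℕ → HarWord M → K} (hf : ∀ n, n ≠ 0 → ∀ w : HarWord M,
      f n w = (1 / ι w.head) ^ n * f n (ofRatios 1 w.ratios)) (w : HarWord M) :
    Finsupp.linearCombination (TateField K) (familyGerm N n₀ f) (expansion n₀ ι hG w) =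
      ClassGerm.of N n₀ fun n => harIhara G f n w := by
  rw [of_harIhara hG, expansion, map_sum]
  refine Finset.sum_congr rfl fun w' _ => ?_
  rw [Finsupp.linearCombination_single, map_mul, mul_smul]
  congr 1
  rw [familyGerm, ← of_mul_pow_class ι hN, ClassGerm.of_eq_of]
  filter_upwards [eventually_class_ne_zero (N := N) (n₀ := n₀)] with m hm
  exact (hf _ hm w').symm

theorem expansion_nil (hG : IsAdjointSeries G) (w : HarWord M) :
    expansion n₀ ι hG w [] = algebraMap (TateRing K) (TateField K)
      (TateRing.X ^ ratioWeight w.tail *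
        ∑ x, TateRing.C ((1 / ι x) ^ n₀) * headSeries hG w x) := by
  classical
  rw [expansion, Finsupp.finsetSum_apply, Finset.mul_sum, map_sum]
  symm
  refine Finset.sum_of_injOn (fun x => ⟨x, []⟩) ?_ ?_ ?_ ?_
  · intro x _ y _ h
    simpa using h
  · intro x _
    rw [Finset.mem_coe, mem_harWordsUpTo, HarWord.length_toWord, HarWord.length_toWord]
    simp [ratioWeight]
  · intro w' _ hw'
    rw [Finsupp.single_eq_of_ne]
    intro h
    refine hw' ⟨w'.head, Finset.mem_coe.2 (Finset.mem_univ _), ?_⟩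
    rw [← w'.ofRatios_ratios, ← h]
    rfl
  · intro x _
    change _ = Finsupp.single [] _ []
    rw [Finsupp.single_eq_same, transition_nil]
    congr 1
    ring

/-- The comparison of the coefficients of the empty word in the quasi-shuffle relation for
`G ∘_har f`, on the class of `n₀` modulo `N`. -/
theorem sum_headSeries_mul_eq (hN : ∀ z, ι z ^ N = 1) (hG : IsAdjointSeries G)
    {f : ℕ → HarWord M → K} (hf : ∀ n, n ≠ 0 → ∀ w : HarWord M,
      f n w = (1 / ι w.head) ^ n * f n (ofRatios 1 w.ratios))
    (hqf : QuasiShuffle f) (hqgf : QuasiShuffle (harIhara G f))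
    (hlin : LinearIndependent (TateField K) (familyGerm N n₀ f)) (y z : M)
    (u v : List (ℕ+ × M)) :
    (∑ x, TateRing.C ((1 / ι x) ^ n₀) * headSeries hG (ofRatios y u) x) *
      (∑ x, TateRing.C ((1 / ι x) ^ n₀) * headSeries hG (ofRatios z v) x) =
    ((stuffle u v).map fun w =>
      ∑ x, TateRing.C ((1 / ι x) ^ n₀) * headSeries hG (ofRatios (y * z) w) x).sum := by
  have hF : ∀ u v, familyGerm N n₀ f u * familyGerm N n₀ f v =
      ((stuffle u v).map (familyGerm N n₀ f)).sum := fun u v => by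
    refine Eq.trans ?_ (of_list_sum (stuffle u v) fun w n => f n (ofRatios 1 w))
    rw [familyGerm, familyGerm, ← map_mul]
    refine congrArg _ (funext fun n => ?_)
    simpa using hqf n 1 1 u v
  have h1 : stuffleMul (expansion n₀ ι hG (ofRatios y u)) (expansion n₀ ι hG (ofRatios z v)) =
      ((stuffle u v).map fun w => expansion n₀ ι hG (ofRatios (y * z) w)).sum := by
    refine hlin ?_
    rw [linearCombination_stuffleMul hF, linearCombination_expansion ι hN hG hf,
      linearCombination_expansion ι hN hG hf, map_list_sum, List.map_map, Function.comp_def]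
    simp only [linearCombination_expansion ι hN hG hf]
    rw [← of_list_sum, ← map_mul]
    exact congrArg _ (funext fun n => hqgf n y z u v)
  have h2 := congrArg (Finsupp.applyAddHom []) h1
  rw [map_list_sum, List.map_map, Function.comp_def] at h2
  simp only [Finsupp.applyAddHom_apply, stuffleMul_nil, expansion_nil,
    ratioWeight_ofRatios_tail] at h2
  have h3 : ((stuffle u v).map fun w => algebraMap (TateRing K) (TateField K)
      (TateRing.X ^ ratioWeight w *
        ∑ x, TateRing.C ((1 / ι x) ^ n₀) * headSeries hG (ofRatios (y * z) w) x)) =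
      (stuffle u v).map fun w => algebraMap (TateRing K) (TateField K)
      (TateRing.X ^ (ratioWeight u + ratioWeight v) *
        ∑ x, TateRing.C ((1 / ι x) ^ n₀) * headSeries hG (ofRatios (y * z) w) x) :=
    List.map_congr_left fun w hw => by rw [ratioWeight_of_mem_stuffle hw]
  rw [h3, ← map_mul] at h2
  have h4 : ∀ l : List (List (ℕ+ × M)), (l.map fun w => algebraMap (TateRing K) (TateField K)
      (TateRing.X ^ (ratioWeight u + ratioWeight v) *
        ∑ x, TateRing.C ((1 / ι x) ^ n₀) * headSeries hG (ofRatios (y * z) w) x)).sum =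
      algebraMap (TateRing K) (TateField K) (TateRing.X ^ (ratioWeight u + ratioWeight v) *
        (l.map fun w =>
          ∑ x, TateRing.C ((1 / ι x) ^ n₀) * headSeries hG (ofRatios (y * z) w) x).sum) := by
    intro l
    induction l with
    | nil => simp
    | cons w l ih => rw [List.map_cons, List.sum_cons, ih, List.map_cons, List.sum_cons,
        mul_add, map_add]
  rw [h4] at h2
  -- both sides carry the same power of `n`, since the quasi-shuffle product preserves the weight
  refine mul_left_cancel₀ (pow_ne_zero (ratioWeight u + ratioWeight v) TateRing.X_ne_zero)
    (Eq.trans ?_ (IsFractionRing.injective (TateRing K) (TateField K) h2))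
  rw [pow_add]
  ring

/-- Separation of the characters `n ↦ (1 / ι x) ^ n`. -/
theorem sum_headSeries_mul_apply_eq (hι : Function.Injective ι) (hG : IsAdjointSeries G) (y z : M)
    (u v : List (ℕ+ × M))
    (h : ∀ n₀ : ℕ, (∑ x, TateRing.C ((1 / ι x) ^ n₀) * headSeries hG (ofRatios y u) x) *
      (∑ x, TateRing.C ((1 / ι x) ^ n₀) * headSeries hG (ofRatios z v) x) =
    ((stuffle u v).map fun w =>
      ∑ x, TateRing.C ((1 / ι x) ^ n₀) * headSeries hG (ofRatios (y * z) w) x).sum)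
    (t : M) (n : ℤ) :
    ∑ x, headSeries hG (ofRatios y u) x n * headSeries hG (ofRatios z v) (t / x) n =
      ((stuffle u v).map fun w => headSeries hG (ofRatios (y * z) w) t n).sum := by
  have hinj : Function.Injective fun x => 1 / ι x := fun x x' hx => hι (by simpa using hx)
  have key : (fun t => (∑ x, headSeries hG (ofRatios y u) x n *
      headSeries hG (ofRatios z v) (t / x) n) -
      ((stuffle u v).map fun w => headSeries hG (ofRatios (y * z) w) t n).sum) = 0 := by
    refine eq_zero_of_forall_sum_mul_pow_eq_zero hinj _ fun i => ?_
    have h1 := congrArg (fun F : TateRing K => F n) (h i)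
    simp only [TateRing.mul_apply, TateRing.sum_apply, TateRing.C_apply] at h1
    have h2 : ∀ l : List (List (ℕ+ × M)), (l.map fun w => ∑ x, TateRing.C ((1 / ι x) ^ i) *
          headSeries hG (ofRatios (y * z) w) x).sum n =
        ∑ x, (l.map fun w => headSeries hG (ofRatios (y * z) w) x n).sum * (1 / ι x) ^ i := by
      intro l
      induction l with
      | nil => simp
      | cons w l ih =>
        rw [List.map_cons, List.sum_cons, TateRing.add_apply, ih, TateRing.sum_apply,
          ← Finset.sum_add_distrib]
        refine Finset.sum_congr rfl fun x _ => ?_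
        rw [List.map_cons, List.sum_cons, TateRing.mul_apply, TateRing.C_apply]
        ring
    rw [h2] at h1
    simp only [sub_mul, Finset.sum_sub_distrib]
    rw [← h1, sub_eq_zero, Finset.sum_mul_sum]
    simp only [Finset.sum_mul]
    rw [Finset.sum_comm]
    refine Finset.sum_congr rfl fun x _ => ?_
    rw [← Equiv.sum_comp (Equiv.mulLeft x)]
    refine Finset.sum_congr rfl fun x' _ => ?_
    simp only [Equiv.coe_mulLeft, mul_div_cancel_left, map_mul]
    rw [← one_div_mul_one_div, mul_pow]
    ring
  exact sub_eq_zero.1 (congrFun key t)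

/-- The theorem over any complete ultrametric field of characteristic `0` in which the `p ^ j`
tend to `0`. -/
theorem adjointQuasiShuffle_of_harIhara (hN : ∀ z, ι z ^ N = 1) (hι : Function.Injective ι)
    {p : ℕ} (hp0 : p ≠ 0) (hp : Tendsto (fun j : ℕ => ((p ^ j : ℤ) : K)) atTop (𝓝 0))
    {F : Series M K} (hF : IsAdjointSeries F) (hG : IsAdjointSeries G)
    (hqf : QuasiShuffle (harIhara F (har ι)))
    (hqgf : QuasiShuffle (harIhara G (harIhara F (har ι)))) : AdjointQuasiShuffle G := by
  have hf : ∀ n, n ≠ 0 → ∀ w : HarWord M, harIhara F (har ι) n w =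
      (1 / ι w.head) ^ n * harIhara F (har ι) n (ofRatios 1 w.ratios) := fun n hn w =>
    eq_pow_mul_of_quasiShuffle ι hqf (fun z => by
      rw [harIhara_apply_nil hF _ hn]
      simp [har, nestedSum]) w
  intro b t u v
  have h1 := sum_headSeries_mul_apply_eq ι hι hG t 1 u v (fun n₀ =>
    sum_headSeries_mul_eq ι hN hG hf hqf hqgf
      (linearIndependent_familyGerm (n₀ := n₀) ι hN hι hp0 hp hF) t 1 u v) 1
  have h2 := HasExpansion.sum Finset.univ fun x : M =>
    (hasExpansion_headSeries hG t x u).mul (hasExpansion_headSeries hG 1 (1 / x) v)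
  have h3 := HasExpansion.list_sum (stuffle u v) fun w =>
    hasExpansion_headSeries hG (t * 1) 1 w
  have h4 := congrFun (h3.unique ((funext h1 : _ = _) ▸ h2)) b
  simp only [mul_one, div_one, one_div, div_inv_eq_mul, one_mul] at h4
  rw [h4, Finset.sum_comm, Finset.Nat.sum_antidiagonal_eq_sum_range_succ_mk]
  refine Finset.sum_congr rfl fun c _ => ?_
  rw [← Equiv.sum_comp (Equiv.divLeft t)]
  exact Finset.sum_congr rfl fun x _ => by simp

end Main

end HarmonicIhara

open HarmonicIhara

/-- `K` is the fraction field of the Witt vectors of a finite field `k` of characteristic `p` that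
contains a primitive `N`-th root of unity, with the `p`-adic absolute value. -/
theorem mainTheorem1 (p : ℕ) [Fact p.Prime] (k : Type*) [Field k] [Finite k] [CharP k p]
    (N : ℕ) [NeZero N] (hN : ∃ ζ : k, IsPrimitiveRoot ζ N)
    (K : Type*) [NormedField K] [Algebra (WittVector p k) K] [IsFractionRing (WittVector p k) K]
    (hK : ∀ a : WittVector p k, ‖algebraMap (WittVector p k) K a‖ ≤ 1)
    (hp : ‖(p : K)‖ = (p : ℝ)⁻¹)
    [Fintype (rootsOfUnity N K)]
    (α : ℕ) (hα : 1 ≤ α)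
    (g : Series (rootsOfUnity N K) K) (hg : g ∈ AdPiTildeSigma (rootsOfUnity N K) K)
    (f : ℕ → HarWord (rootsOfUnity N K) → K) (hf : f ∈ orbitHar N K (p ^ α))
    (hqf : QuasiShuffle f) (hqgf : QuasiShuffle (harIhara g f)) :
    AdjointQuasiShuffle g := by
  have hpp : p.Prime := Fact.out
  have hq1 : (p : ℝ)⁻¹ < 1 := inv_lt_one_of_one_lt₀ (by exact_mod_cast hpp.one_lt)
  have : IsUltrametricDist K := isUltrametricDist_of_witt hK
  have : CompleteSpace K := completeSpace_of_witt hK hp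
  have : CharZero K := charZero_of_witt hK hp
  obtain ⟨ζ, hζ⟩ := hN
  -- a field of characteristic `p` has a primitive `N`-th root of unity only if `p ∤ N`
  have hcop : N.Coprime (p ^ α) := by
    refine (((hpp.coprime_iff_not_dvd).2 fun h => ?_).pow_left α).symm
    have := hζ.neZero'
    exact NeZero.ne (N : k) ((CharP.cast_eq_zero_iff k p N).2 h)
  let ι : rootsOfUnity N K →* K :=
    (powMonoidHom (p ^ α)).comp ((Units.coeHom K).comp (rootsOfUnity N K).subtype)
  have hι : ∀ z, ι z = ((z : Kˣ) : K) ^ p ^ α := fun z => rfl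
  have hz : ∀ z : rootsOfUnity N K, z ^ N = 1 := fun z => Subtype.ext ((mem_rootsOfUnity N _).1 z.2)
  have hinj : Function.Injective ι := by
    rw [injective_iff_map_eq_one]
    intro z h1
    have h2 : z ^ p ^ α = 1 := by
      ext
      simpa [hι] using h1
    have := Nat.dvd_gcd (orderOf_dvd_of_pow_eq_one (hz z)) (orderOf_dvd_of_pow_eq_one h2)
    rwa [hcop.gcd_eq_one, Nat.dvd_one, orderOf_eq_one_iff] at this
  have hp_tendsto : Tendsto (fun j : ℕ => ((p ^ j : ℤ) : K)) atTop (𝓝 0) := by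
    rw [tendsto_zero_iff_norm_tendsto_zero]
    simpa [hp] using tendsto_pow_atTop_nhds_zero_of_lt_one (by positivity) hq1
  obtain ⟨F, hF, rfl⟩ := hf
  exact adjointQuasiShuffle_of_harIhara ι (fun z => by rw [← map_pow, hz, map_one]) hinj
    hpp.ne_zero hp_tendsto (isAdjointSeries_of_mem hF) (isAdjointSeries_of_mem hg) hqf hqgf
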